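/- \textbf{Model.} A typical user is at the origin of $\mathbb R^2$. For $i\in\{1,2\}$ (tier $1$: macro, tier $2$: pico) the base stations (BSs) of tier $i$ form a homogeneous Poisson point process $\Phi_i$ of density $\lambda_i>0$. Files $1,\dots,N_c$ ($N_c\ge1$) are requested with the Zipf probabilities $P_f=f^{-\delta}/\sum_{n=1}^{N_c}n^{-\delta}$, $\delta\ge 0$. Each BS of tier $i$ stores $M_i$ of the files $1,\dots,H_c$, where $\max(M_1,M_2)\le H_c\le N_c$, and stores file $f\le H_c$ with probability $p_{i,f}\in[0,1]$, $\sum_{f\le H_c}p_{i,f}=M_i$. The path losses are $L_1(r)=C_1r^{-\alpha_1}$ and $L_2(r)=\mathbf 1_{r\le R_L}C_2r^{-\alpha_2}$ ($C_i,\alpha_i,R_L>0$). The fading powers $g_x$ are Gamma distributed with mean $1$ and shape $N^p_1=1$ in tier $1$, $N^p_2\in\{1,2,\dots\}$ in tier $2$. The array gains are $G_1=1$ and $G_2(\omega)=\sin^2(\pi N_2\omega)/(N_2^2\sin^2(\pi\omega))$ with $\omega_x$ uniform on $[-d/\lambda,d/\lambda]$ ($d,\lambda>0$). BS locations of the two tiers,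 requested file, fadings, angles and cache contents of the BSs are all mutually independent. With transmit powers $P_i^{tx}>0$, antenna numbers $N_i\ge1$ and noise powers $\sigma_i^2\ge0$, the SINR when the user is served by $x_0\in\Phi_i$ is \[ \Upsilon_i(x_0)=\frac{P_i^{tx}L_i(\|x_0\|)N_ig_{x_0}}{\sigma_i^2+\sum_{x\in\Phi_i\setminus\{x_0\}}P_i^{tx}L_i(\|x\|)N_ig_xG_i(\omega_x)}\in[0,\infty] \] (with $0/0=0$ and $a/0=\infty$ for $a>0$). Let $\Upsilon_{i,f}=\Upsilon_i(x_0)$ for the nearest BS $x_0$ of tier $i$ that stores $f$ ($\Upsilon_{i,f}=0$ if there is none) and $\Upsilon_1=\Upsilon_1(x_0)$ for the nearest macro BS $x_0$. \textbf{Success.} Let $B_i,b_i>0$ be the bandwidths and bias factors, $C_{bh}$ the backhaul capacity, and $R_{th}\ge0$. If the requested file is $f\le H_c$, the user associates with the tier $i$ for which $b_iB_i\log_2(1+\Upsilon_{i,f})>b_jB_j\log_2(1+\Upsilon_{j,f})$, $j\ne i$, and the request succeeds if $B_i\log_2(1+\Upsilon_{i,f})>R_{th}$. If $f>H_c$, it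 succeeds if $C_{bh}\ge R_{th}$ and $B_1\log_2(1+\Upsilon_1)>R_{th}$. Let $\mathcal P_R(R_{th})$ be the probability of success. Put $P_{\Upsilon_{i,f}}(\tau)=\mathbb P[\Upsilon_{i,f}>\tau]$, $P_{\Upsilon_1}(\tau)=\mathbb P[\Upsilon_1>\tau]$, $p_{\Upsilon_{i,f}}=-\frac{d}{d\tau}P_{\Upsilon_{i,f}}$, and \[ f^R_{i,f}(\tau)=p_{\Upsilon_{i,f}}(\tau)\Big(1-P_{\Upsilon_{j,f}}\big((1+\tau)^{\frac{b_iB_i}{b_jB_j}}-1\big)\Big)\quad(j\neq i), \] \[ P_S(R_{th})=\mathbf U(C_{bh}-R_{th})\,\mathbf U(N_c-H_c-1)\sum_{f=H_c+1}^{N_c}P_f\,P_{\Upsilon_1}\big(2^{R_{th}/B_1}-1\big), \] where $\mathbf U(x)=1$ for $x\ge0$ and $\mathbf U(x)=0$ for $x<0$. \textbf{Theorem.} For all $f\le H_c$ and $i\in\{1,2\}$, $P_{\Upsilon_{i,f}}$ is differentiable on $(0,\infty)$ and $f^R_{i,f}$ is integrable on $(2^{R_{th}/B_i}-1,\infty)$.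 If $\sigma_2^2>0$, then \[ \mathcal P_R(R_{th})=\sum_{f=1}^{H_c}\sum_{i=1}^2P_f\int_{2^{R_{th}/B_i}-1}^\infty f^R_{i,f}(\tau)\,d\tau+P_S(R_{th}). \] In the interference-limited case $\sigma_2^2=0$ this formula holds up to the probability that the pico tier offers an interference-free link (infinite SINR) to a requested cached file, namely \[ \mathcal P_R(R_{th})=\sum_{f=1}^{H_c}\sum_{i=1}^2P_f\int_{2^{R_{th}/B_i}-1}^\infty f^R_{i,f}(\tau)\,d\tau+P_S(R_{th})+\sum_{f=1}^{H_c}P_f\,p_{2,f}\,\pi\lambda_2R_L^2\,e^{-\pi\lambda_2R_L^2}. \] -/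

import Mathlib

open MeasureTheory ProbabilityTheory Set
open scoped ENNReal NNReal

noncomputable section

/-- The two tiers of base stations (BSs): sub-6 GHz macro BSs and mmWave pico BSs. -/
inductive Tier where
  | macroBS
  | picoBS
  deriving DecidableEq

instance : Fintype Tier := ⟨{Tier.macroBS, Tier.picoBS}, by intro x; cases x <;> simp⟩

/-- The tier different from `i`. -/
def Tier.other : Tier → Tier
  | .macroBS => .picoBS
  | .picoBS => .macroBS

/-- The plane in which BSs are located; the typical user is at the origin. -/
abbrev Plane : Type := EuclideanSpace ℝ (Fin 2)

/-- The deterministic parameters of the network. -/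
structure HetNetParams where
  /-- density of BSs -/
  density : Tier → ℝ
  density_pos : ∀ i, 0 < density i
  /-- transmit power -/
  power : Tier → ℝ
  power_pos : ∀ i, 0 < power i
  /-- path loss intercept -/
  intercept : Tier → ℝ
  intercept_pos : ∀ i, 0 < intercept i
  /-- path loss exponent -/
  exponent : Tier → ℝ
  exponent_pos : ∀ i, 0 < exponent i
  /-- radius of the line-of-sight ball of the pico tier -/
  losRadius : ℝ
  losRadius_pos : 0 < losRadius
  /-- number of antenna elements of a BS -/
  antennas : Tier → ℕ
  antennas_pos : ∀ i, 0 < antennas i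
  /-- antenna spacing at pico BSs -/
  spacing : ℝ
  spacing_pos : 0 < spacing
  /-- wavelength used by pico BSs -/
  wavelength : ℝ
  wavelength_pos : 0 < wavelength
  /-- Nakagami parameter of the pico tier -/
  nakagami : ℕ
  nakagami_pos : 0 < nakagami
  /-- thermal noise power -/
  noise : Tier → ℝ
  noise_nonneg : ∀ i, 0 ≤ noise i
  /-- bandwidth per resource block -/
  bandwidth : Tier → ℝ
  bandwidth_pos : ∀ i, 0 < bandwidth i
  /-- bias factor of the maximum rate association -/
  bias : Tier → ℝ
  bias_pos : ∀ i, 0 < bias i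
  /-- capacity of the backhaul between the server and a macro BS -/
  backhaul : ℝ
  /-- number of files in the catalog -/
  numFiles : ℕ
  numFiles_pos : 0 < numFiles
  /-- the files `1, …, numCached` are those that may be cached at BSs -/
  numCached : ℕ
  numCached_le : numCached ≤ numFiles
  /-- number of files that a BS can store -/
  storage : Tier → ℕ
  storage_le : ∀ i, storage i ≤ numCached
  /-- skew of the popularity distribution -/
  skew : ℝ
  skew_nonneg : 0 ≤ skew
  /-- probability that a BS of the given tier stores the given file -/
  cacheProb : Tier → ℕ → ℝ
  cacheProb_mem : ∀ i, ∀ f ∈ Finset.Icc 1 numCached, cacheProb i f ∈ Icc (0 : ℝ) 1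
  cacheProb_sum : ∀ i, ∑ f ∈ Finset.Icc 1 numCached, cacheProb i f = storage i

/-- The unit step function. -/
def unitStep (x : ℝ) : ℝ := if 0 ≤ x then 1 else 0

namespace HetNetParams

variable (par : HetNetParams)

/-- Zipf probability that file `f` (with `1 ≤ f ≤ numFiles`) is requested. -/
def zipf (f : ℕ) : ℝ :=
  (f : ℝ) ^ (-par.skew) / ∑ n ∈ Finset.Icc 1 par.numFiles, (n : ℝ) ^ (-par.skew)

/-- Path loss at distance `r`; in the pico tier only line-of-sight links count. -/
def pathLoss : Tier → ℝ → ℝ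
  | .macroBS, r => par.intercept .macroBS * r ^ (-par.exponent .macroBS)
  | .picoBS, r =>
      unitStep (par.losRadius - r) * (par.intercept .picoBS * r ^ (-par.exponent .picoBS))

/-- Fading parameter: Rayleigh fading in the macro tier, Nakagami fading in the pico tier. -/
def fadingParam : Tier → ℕ
  | .macroBS => 1
  | .picoBS => par.nakagami

/-- Array gain in direction `w`: omnidirectional macro BSs; uniform linear array at pico BSs
(the quotient has the limit `1` where its denominator vanishes). -/
def arrayGain : Tier → ℝ → ℝ
  | .macroBS, _ => 1
  | .picoBS, w =>
      if Real.sin (Real.pi * w) = 0 then 1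
      else Real.sin (Real.pi * par.antennas .picoBS * w) ^ 2
        / ((par.antennas .picoBS : ℝ) ^ 2 * Real.sin (Real.pi * w) ^ 2)

end HetNetParams

/-- `X 0, X 1, …` are the points, listed by increasing distance to the origin, of a homogeneous
Poisson point process of density `dens` in the plane. -/
structure IsPoissonProcess {Ω : Type*} [MeasurableSpace Ω] (μ : Measure Ω) (dens : ℝ)
    (X : ℕ → Ω → Plane) : Prop where
  measurable : ∀ n, Measurable (X n)
  sorted : ∀ᵐ ω ∂μ, Monotone fun n => ‖X n ω‖
  law_count : ∀ A : Set Plane, MeasurableSet A → volume A ≠ ⊤ → ∀ k : ℕ,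
    μ {ω | {n | X n ω ∈ A}.encard = k} = poissonMeasure (dens * volume.real A).toNNReal {k}
  indep_count : ∀ (m : ℕ) (A : Fin m → Set Plane), (∀ j, MeasurableSet (A j)) →
    (∀ j, volume (A j) ≠ ⊤) → Pairwise (Function.onFun Disjoint A) →
    iIndepFun (fun j ω => {n | X n ω ∈ A j}.encard) μ

/-- The random quantities of the network, as functions on a sample space. -/
structure HetNet (Ω : Type*) where
  /-- the file requested by the typical user -/
  request : Ω → ℕ
  /-- location of the `n`-th nearest BS (counted from `0`) of a tier -/
  loc : Tier → ℕ → Ω → Plane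
  /-- small-scale fading power of the link from that BS to the typical user -/
  fading : Tier → ℕ → Ω → ℝ
  /-- difference of angles of departure of an interfering pico BS -/
  angle : ℕ → Ω → ℝ
  /-- the files stored at that BS -/
  cache : Tier → ℕ → Ω → Set ℕ

/-- Names of the sources of randomness. -/
inductive Source where
  | request
  | location (i : Tier)
  | fading (i : Tier) (n : ℕ)
  | angle (n : ℕ)
  | cache (i : Tier) (n : ℕ)

namespace HetNet

variable {Ω : Type*}

/-- The σ-algebra generated by a source of randomness. -/
@[reducible] def sourceAlgebra (net : HetNet Ω) : Source → MeasurableSpace Ω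
  | .request => MeasurableSpace.comap net.request inferInstance
  | .location i => MeasurableSpace.comap (fun ω n => net.loc i n ω) inferInstance
  | .fading i n => MeasurableSpace.comap (net.fading i n) inferInstance
  | .angle n => MeasurableSpace.comap (net.angle n) inferInstance
  | .cache i n => MeasurableSpace.comap (net.cache i n) inferInstance

/-- `net` is a realization of the network model with parameters `par` on the probability space
`(Ω, μ)`. -/
structure IsModel [MeasurableSpace Ω] (net : HetNet Ω) (par : HetNetParams) (μ : Measure Ω) :
    Prop where
  measurable_request : Measurable net.request
  measurable_fading : ∀ i n, Measurable (net.fading i n)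
  measurable_angle : ∀ n, Measurable (net.angle n)
  measurable_cache : ∀ i n, Measurable (net.cache i n)
  law_request : ∀ f ∈ Finset.Icc 1 par.numFiles,
    μ {ω | net.request ω = f} = ENNReal.ofReal (par.zipf f)
  law_location : ∀ i, IsPoissonProcess μ (par.density i) (net.loc i)
  law_fading : ∀ i n,
    μ.map (net.fading i n) = gammaMeasure (par.fadingParam i) (par.fadingParam i)
  law_angle : ∀ n, pdf.IsUniform (net.angle n)
    (Icc (-(par.spacing / par.wavelength)) (par.spacing / par.wavelength)) μ
  law_cache : ∀ i n, ∀ f ∈ Finset.Icc 1 par.numCached,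
    μ {ω | f ∈ net.cache i n ω} = ENNReal.ofReal (par.cacheProb i f)
  cache_full : ∀ i n, ∀ᵐ ω ∂μ,
    net.cache i n ω ⊆ Icc 1 par.numCached ∧ (net.cache i n ω).encard = par.storage i
  indep : iIndep net.sourceAlgebra μ

variable (net : HetNet Ω) (par : HetNetParams)

/-- Interference at the typical user when it is served by BS `k` of tier `i`: all other BSs of the
tier interfere, whether or not they store the requested file. -/
def interference (i : Tier) (k : ℕ) (ω : Ω) : ℝ≥0∞ :=
  ∑' n : ℕ, if n = k then 0 else
    ENNReal.ofReal (par.power i * par.pathLoss i ‖net.loc i n ω‖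
      * (par.antennas i * net.fading i n ω * par.arrayGain i (net.angle n ω)))

/-- SINR at the typical user when it is served by BS `k` of tier `i`, whose beam is aligned
(directivity gain `1`). It is `∞` if there is a signal but neither noise nor interference, and `0`
if there is no signal. -/
def sinrFrom (i : Tier) (k : ℕ) (ω : Ω) : ℝ≥0∞ :=
  ENNReal.ofReal
      (par.power i * par.pathLoss i ‖net.loc i k ω‖ * (par.antennas i * net.fading i k ω))
    / (ENNReal.ofReal (par.noise i) + net.interference par i k ω)

open Classical in
/-- SINR for file `f` from tier `i`: the serving BS is the nearest one of the tier that stores `f`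
(`0` if there is none). -/
def sinr (i : Tier) (f : ℕ) (ω : Ω) : ℝ≥0∞ :=
  if ∃ n, f ∈ net.cache i n ω then net.sinrFrom par i (sInf {n | f ∈ net.cache i n ω}) ω else 0

/-- SINR in server mode: the serving BS is the nearest macro BS. -/
def serverSinr (ω : Ω) : ℝ≥0∞ := net.sinrFrom par .macroBS 0 ω

end HetNet

/-- The data rate `B log₂ (1 + s)`. -/
def dataRate (B : ℝ) (s : ℝ≥0∞) : ℝ≥0∞ :=
  if s = ⊤ then ⊤ else ENNReal.ofReal (B * Real.logb 2 (1 + s.toReal))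

namespace HetNet

variable {Ω : Type*} (net : HetNet Ω) (par : HetNetParams)

/-- The rate for file `f` from tier `i`. -/
def tierRate (i : Tier) (f : ℕ) (ω : Ω) : ℝ≥0∞ :=
  dataRate (par.bandwidth i) (net.sinr par i f ω)

/-- Max-Rate association: requesting `f`, the user is associated with tier `i`, because this tier
offers the larger biased rate. -/
def Associated (i : Tier) (f : ℕ) (ω : Ω) : Prop :=
  ENNReal.ofReal (par.bias i.other) * net.tierRate par i.other f ω
    < ENNReal.ofReal (par.bias i) * net.tierRate par i f ω

/-- The event that the request of the typical user succeeds under Max-Rate association with rate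
threshold `R`. A cached file comes from the associated tier, any other file comes from the server
through the nearest macro BS and the backhaul. -/
def Success (R : ℝ) (ω : Ω) : Prop :=
  (net.request ω ≤ par.numCached ∧ ∃ i, net.Associated par i (net.request ω) ω ∧
      ENNReal.ofReal R < net.tierRate par i (net.request ω) ω) ∨
  (par.numCached < net.request ω ∧ R ≤ par.backhaul ∧
      ENNReal.ofReal R < dataRate (par.bandwidth .macroBS) (net.serverSinr par ω))

variable [MeasurableSpace Ω] (μ : Measure Ω)

/-- Success probability under Max-Rate association. -/
def successProb (R : ℝ) : ℝ := μ.real {ω | net.Success par R ω}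

/-- Cache-related coverage probability of tier `i` for file `f` at SINR threshold `t`. -/
def coverage (i : Tier) (f : ℕ) (t : ℝ) : ℝ :=
  μ.real {ω | ENNReal.ofReal t < net.sinr par i f ω}

/-- Coverage probability of the macro tier without caching (every BS is eligible). -/
def serverCoverage (t : ℝ) : ℝ := μ.real {ω | ENNReal.ofReal t < net.serverSinr par ω}

/-- The probability density belonging to `coverage`. -/
def coveragePDF (i : Tier) (f : ℕ) (t : ℝ) : ℝ := -deriv (net.coverage par μ i f) t

/-- The density of the coverage probability of tier `i` for file `f` under Max-Rate association. -/
def maxRatePDF (i : Tier) (f : ℕ) (t : ℝ) : ℝ :=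
  net.coveragePDF par μ i f t *
    (1 - net.coverage par μ i.other f
      ((1 + t) ^ (par.bias i * par.bandwidth i / (par.bias i.other * par.bandwidth i.other)) - 1))

/-- The server-mode term. -/
def serverTerm (R : ℝ) : ℝ :=
  unitStep (par.backhaul - R) * unitStep ((par.numFiles : ℝ) - par.numCached - 1) *
    ∑ f ∈ Finset.Icc (par.numCached + 1) par.numFiles,
      par.zipf f * net.serverCoverage par μ (2 ^ (R / par.bandwidth .macroBS) - 1)

end HetNet

end

/-! For a fixed requested file, the SINRs of the two tiers are independent, being functions of
disjoint families of independent sources. Let `Y` and `Z` be the SINRs of tier `i` and of the other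
tier. Association with tier `i` reads `Z < φ(Y)` with `φ(t) = (1 + t) ^ c - 1`, as long as `Y` is
finite, and the rate condition reads `Y > 2 ^ (R / B) - 1`. Conditioning on `Y` therefore gives the
integral of the density of `Y` times `P[Z < φ(t)]` (`measure_lt_eq_integral_deriv_tail`), provided
that the laws have no atoms in `(0, ∞)` and that `Y` has minus the derivative of its tail as density
there. Both follow from differentiability of the tail. Atoms at `0` are harmless.

Differentiability comes from the fading of the serving BS. The SINR is a sum over `k` of a factor `Z
k` times the fading of BS `k`, where `Z k` vanishes unless BS `k` serves and does not involve that
fading (`sinr_eq_tsum`). Hence the tail at `t` is the expectation of `γ(x : V x > t)`, with `γ` the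
Gamma law and `V = ∑ Z k` (`tail_tsum_mul_eq`). The `t`-derivative of the integrand is `-p(t / V) /
V`, and this is at most `C / t` in absolute value whatever `V` is, because `x p(x)` is bounded.
Dominated differentiation applies without any knowledge of the law of the interference
(`differentiableOn_integral_scaledTail`).

What the integral misses is the event `Y = ∞`. In the macro tier it is null, since other macro BSs
always interfere. In the pico tier it is empty if there is noise. Without noise it occurs, almost
surely, exactly when the line-of-sight ball contains one BS and that BS stores the file: a caching
probability times a Poisson probability. On this event the pico tier wins the association, the macro
SINR being finite, and its mass is the correction term (`measure_associated`,
`measure_sinr_pico_eq_top`).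

Finally the request is independent of everything else, so the success probability is the Zipf
average over the files (`successProb_eq_sum`). -/

open Filter Topology

/-! ### Tails of extended nonnegative random variables and comparison of independent ones. -/

section Tail

variable {Ω : Type*} [MeasurableSpace Ω] {μ : Measure Ω} {Y Z : Ω → ℝ≥0∞}

/-- The complementary distribution function of an extended nonnegative random variable. -/
def tail (μ : Measure Ω) (Y : Ω → ℝ≥0∞) (t : ℝ) : ℝ := μ.real {ω | ENNReal.ofReal t < Y ω}

lemma tail_nonneg (t : ℝ) : 0 ≤ tail μ Y t := measureReal_nonneg

lemma hasDerivAt_tail (hd : DifferentiableOn ℝ (tail μ Y) (Ioi 0)) {t : ℝ} (ht : 0 < t) :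
    HasDerivAt (tail μ Y) (deriv (tail μ Y) t) t :=
  ((hd t ht).differentiableAt (Ioi_mem_nhds ht)).hasDerivAt

lemma measurableSet_tail (hY : Measurable Y) (t : ℝ) :
    MeasurableSet {ω | ENNReal.ofReal t < Y ω} := measurableSet_lt measurable_const hY

variable [IsProbabilityMeasure μ]

lemma tail_antitone : Antitone (tail μ Y) := fun _ _ h =>
  measureReal_mono fun _ hω => (ENNReal.ofReal_le_ofReal h).trans_lt hω

lemma tail_le_one (t : ℝ) : tail μ Y t ≤ 1 := measureReal_le_one

/-- The limit is the mass at infinity and need not be `0`; this is where the correction in the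
noiseless case originates. -/
lemma tail_tendsto_atTop (hY : Measurable Y) :
    Tendsto (tail μ Y) atTop (𝓝 (μ.real {ω | Y ω = ⊤})) := by
  have h := tendsto_measure_iInter_atTop (μ := μ) (s := fun t : ℝ => {ω | ENNReal.ofReal t < Y ω})
    (fun t => (measurableSet_tail hY t).nullMeasurableSet)
    (fun _ _ h _ hω => (ENNReal.ofReal_le_ofReal h).trans_lt hω) ⟨0, measure_ne_top _ _⟩
  have e : (⋂ t : ℝ, {ω | ENNReal.ofReal t < Y ω}) = {ω | Y ω = ⊤} := by
    ext ω
    simp only [mem_iInter, mem_ofPred_eq]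
    refine ⟨fun H => ?_, fun H => by simp [H]⟩
    by_contra hne
    have := H (Y ω).toReal
    rw [ENNReal.ofReal_toReal hne] at this
    exact lt_irrefl _ this
  rw [e] at h
  exact (ENNReal.tendsto_toReal (measure_ne_top _ _)).comp h

/-- Needed for the fundamental theorem of calculus on `Ioi a` when `a = 0`, where the tail need not
be differentiable. The strict inequality in `tail` makes it right-continuous even if `Y` has an atom
at `a`. -/
lemma tail_continuousWithinAt (hY : Measurable Y) (a : ℝ) :
    ContinuousWithinAt (tail μ Y) (Ici a) a := by
  have h := tendsto_measure_biInter_gt (μ := μ) (s := fun t : ℝ => {ω | Y ω ≤ ENNReal.ofReal t})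
    (a := a) (fun t _ => (measurableSet_le hY measurable_const).nullMeasurableSet)
    (fun _ _ _ h _ hω => le_trans hω (ENNReal.ofReal_le_ofReal h))
    ⟨a + 1, by simp, measure_ne_top _ _⟩
  have e : (⋂ t > a, {ω | Y ω ≤ ENNReal.ofReal t}) = {ω | Y ω ≤ ENNReal.ofReal a} := by
    ext ω
    simp only [mem_iInter, mem_ofPred_eq]
    refine ⟨fun H => ?_, fun H t ht => H.trans (ENNReal.ofReal_le_ofReal (le_of_lt ht))⟩
    have hc : Tendsto (fun t => ENNReal.ofReal t) (𝓝[>] a) (𝓝 (ENNReal.ofReal a)) :=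
      (ENNReal.continuous_ofReal.tendsto a).mono_left nhdsWithin_le_nhds
    exact ge_of_tendsto hc (eventually_nhdsWithin_of_forall fun t ht => H t ht)
  rw [e] at h
  have h2 := (ENNReal.tendsto_toReal (measure_ne_top _ _)).comp h
  have hcompl : ∀ t, tail μ Y t = 1 - μ.real {ω | Y ω ≤ ENNReal.ofReal t} := by
    intro t
    rw [← probReal_compl_eq_one_sub (measurableSet_le hY measurable_const), tail]
    congr 1
    ext
    simp
  rw [← Ioi_insert, continuousWithinAt_insert_self]
  unfold ContinuousWithinAt
  rw [hcompl a]
  refine (h2.const_sub 1).congr fun t => ?_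
  rw [hcompl]; rfl

lemma tail_deriv_nonpos (t : ℝ) : deriv (tail μ Y) t ≤ 0 := tail_antitone.deriv_nonpos

/-- A derivative of constant sign is integrable as soon as its primitive has a finite limit at
infinity; no bound on the density is needed. -/
lemma integrableOn_deriv_tail (hY : Measurable Y) (hd : DifferentiableOn ℝ (tail μ Y) (Ioi 0))
    {a : ℝ} (ha : 0 ≤ a) : IntegrableOn (deriv (tail μ Y)) (Ioi a) :=
  integrableOn_Ioi_deriv_of_nonpos (tail_continuousWithinAt hY a)
    (fun _ ht => hasDerivAt_tail hd (lt_of_le_of_lt ha ht)) (fun t _ => tail_deriv_nonpos t)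
    (tail_tendsto_atTop hY)

lemma integral_deriv_tail (hY : Measurable Y) (hd : DifferentiableOn ℝ (tail μ Y) (Ioi 0))
    {a : ℝ} (ha : 0 ≤ a) :
    ∫ t in Ioi a, deriv (tail μ Y) t = μ.real {ω | Y ω = ⊤} - tail μ Y a :=
  integral_Ioi_of_hasDerivAt_of_nonpos (tail_continuousWithinAt hY a)
    (fun _ ht => hasDerivAt_tail hd (lt_of_le_of_lt ha ht)) (fun t _ => tail_deriv_nonpos t)
    (tail_tendsto_atTop hY)

/-- Where the tail is differentiable, minus its derivative is the density of the law. -/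
lemma map_toReal_eq_withDensity (hY : Measurable Y)
    (hd : DifferentiableOn ℝ (tail μ Y) (Ioi 0)) {a : ℝ} (ha : 0 ≤ a) :
    (μ.restrict {ω | ENNReal.ofReal a < Y ω ∧ Y ω ≠ ⊤}).map (fun ω => (Y ω).toReal) =
      (volume.restrict (Ioi a)).withDensity fun t => ((-deriv (tail μ Y) t).toNNReal : ℝ≥0∞) := by
  have hm : Measurable fun ω => (Y ω).toReal := hY.ennreal_toReal
  have hI : ∀ b, 0 ≤ b → μ {ω | ENNReal.ofReal b < Y ω ∧ Y ω ≠ ⊤} =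
      ∫⁻ t in Ioi b, ((-deriv (tail μ Y) t).toNNReal : ℝ≥0∞) := by
    intro b hb
    have h1 : ∫⁻ t in Ioi b, ((-deriv (tail μ Y) t).toNNReal : ℝ≥0∞) =
        ENNReal.ofReal (∫ t in Ioi b, -deriv (tail μ Y) t) :=
      (ofReal_integral_eq_lintegral_ofReal (integrableOn_deriv_tail hY hd hb).neg
        (ae_of_all _ fun t => neg_nonneg.2 (tail_deriv_nonpos t))).symm
    rw [h1, integral_neg, integral_deriv_tail hY hd hb, neg_sub, tail,
      ← measureReal_sdiff (s₁ := {ω | ENNReal.ofReal b < Y ω}) (s₂ := {ω | Y ω = ⊤})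
        (by intro ω hω; rw [mem_ofPred_eq] at hω; simp [hω])
        (hY (measurableSet_singleton ⊤)), measureReal_def, ENNReal.ofReal_toReal (measure_ne_top _ _)]
    rfl
  refine ext_of_generate_finite _ (borel_eq_generateFrom_Ioi ℝ ▸ BorelSpace.measurable_eq)
    isPiSystem_Ioi ?_ ?_
  · rintro _ ⟨b, rfl⟩
    rw [Measure.map_apply hm measurableSet_Ioi, Measure.restrict_apply (hm measurableSet_Ioi),
      withDensity_apply _ measurableSet_Ioi, Measure.restrict_restrict measurableSet_Ioi,
      Ioi_inter_Ioi, ← hI _ (ha.trans le_sup_right)]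
    congr 1
    ext ω
    simp only [mem_inter_iff, mem_preimage, mem_Ioi, mem_ofPred_eq]
    by_cases hω : Y ω = ⊤
    · simp [hω]
    · rw [← ENNReal.ofReal_toReal hω]
      simp only [ENNReal.toReal_ofReal ENNReal.toReal_nonneg]
      rw [ENNReal.ofReal_lt_ofReal_iff_of_nonneg ha,
        ENNReal.ofReal_lt_ofReal_iff_of_nonneg (ha.trans le_sup_right), sup_lt_iff]
      tauto
  · rw [Measure.map_apply hm MeasurableSet.univ, withDensity_apply _ MeasurableSet.univ]
    simp only [preimage_univ, Measure.restrict_univ, Measure.restrict_apply MeasurableSet.univ,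
      univ_inter]
    exact hI a ha

/-- An atom at `s` would be a jump of the tail: its mass is at most `tail t - tail s` for every `t <
s`, and this tends to `0`. -/
lemma measure_eq_zero_of_tail (hY : Measurable Y) (hd : DifferentiableOn ℝ (tail μ Y) (Ioi 0))
    {s : ℝ} (hs : 0 < s) : μ.real {ω | Y ω = ENNReal.ofReal s} = 0 := by
  refine le_antisymm ?_ measureReal_nonneg
  have hc : Tendsto (fun t => tail μ Y t - tail μ Y s) (𝓝[<] s) (𝓝 (tail μ Y s - tail μ Y s)) :=
    ((hasDerivAt_tail hd hs).continuousAt.tendsto.mono_left nhdsWithin_le_nhds).sub_const _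
  rw [sub_self] at hc
  refine ge_of_tendsto hc (eventually_nhdsWithin_of_forall fun t ht => ?_)
  rw [le_sub_iff_add_le, tail, ← measureReal_union (by
    rw [Set.disjoint_left]; intro ω h1 h2
    rw [mem_ofPred_eq] at h1 h2; rw [h1] at h2; exact lt_irrefl _ h2) (measurableSet_tail hY s)]
  refine measureReal_mono ?_
  have hts := (ENNReal.ofReal_lt_ofReal_iff hs).2 (mem_Iio.1 ht)
  rintro ω (h | h)
  · rw [mem_ofPred_eq] at h ⊢; rwa [h]
  · exact hts.trans h

lemma measure_lt_eq_one_sub_tail (hY : Measurable Y)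
    (hd : DifferentiableOn ℝ (tail μ Y) (Ioi 0)) {s : ℝ} (hs : 0 < s) :
    μ.real {ω | Y ω < ENNReal.ofReal s} = 1 - tail μ Y s := by
  have h : {ω | Y ω < ENNReal.ofReal s} =
      ({ω | ENNReal.ofReal s < Y ω} ∪ {ω | Y ω = ENNReal.ofReal s})ᶜ := by
    ext ω
    simp only [mem_ofPred_eq, mem_compl_iff, mem_union, not_or, not_lt]
    exact ⟨fun h => ⟨h.le, h.ne⟩, fun h => lt_of_le_of_ne h.1 h.2⟩
  have he : MeasurableSet {ω | Y ω = ENNReal.ofReal s} := hY (measurableSet_singleton _)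
  rw [h, probReal_compl_eq_one_sub ((measurableSet_tail hY s).union he),
    measureReal_union (by
      rw [Set.disjoint_left]; intro ω h1 h2
      rw [mem_ofPred_eq] at h1 h2; rw [h2] at h1; exact lt_irrefl _ h1) he,
    measure_eq_zero_of_tail hY hd hs, add_zero]
  rfl

lemma integrableOn_deriv_tail_mul (hY : Measurable Y)
    (hd : DifferentiableOn ℝ (tail μ Y) (Ioi 0)) {φ : ℝ → ℝ} (hφ : Measurable φ) {a : ℝ}
    (ha : 0 ≤ a) :
    IntegrableOn (fun t => -deriv (tail μ Y) t * (1 - tail μ Z (φ t))) (Ioi a) := by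
  refine (integrableOn_deriv_tail hY hd ha).neg.mul_bdd (c := 1)
    ((measurable_const.sub (tail_antitone.measurable.comp hφ)).aestronglyMeasurable)
    (ae_of_all _ fun t => ?_)
  have h0 := tail_nonneg (μ := μ) (Y := Z) (φ t)
  have h1 := tail_le_one (μ := μ) (Y := Z) (φ t)
  rw [Real.norm_eq_abs, abs_le]
  constructor <;> linarith

/-- The probability that `Y` is finite, exceeds `a`, and dominates the independent variable `Z`
after a change of scale. -/
lemma measure_lt_eq_integral_deriv_tail (hY : Measurable Y) (hZ : Measurable Z)
    (hYZ : IndepFun Y Z μ) (hdY : DifferentiableOn ℝ (tail μ Y) (Ioi 0))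
    (hdZ : DifferentiableOn ℝ (tail μ Z) (Ioi 0)) {φ : ℝ → ℝ} (hφ : Measurable φ)
    (hφ0 : ∀ t, 0 < t → 0 < φ t) {a : ℝ} (ha : 0 ≤ a) :
    μ.real {ω | (ENNReal.ofReal a < Y ω ∧ Y ω ≠ ⊤) ∧ Z ω < ENNReal.ofReal (φ (Y ω).toReal)} =
      ∫ t in Ioi a, -deriv (tail μ Y) t * (1 - tail μ Z (φ t)) := by
  set A : Set Ω := {ω | ENNReal.ofReal a < Y ω ∧ Y ω ≠ ⊤} with hA
  have hAm : MeasurableSet A :=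
    (measurableSet_tail hY a).inter (hY (measurableSet_singleton ⊤)).compl
  have hh : Measurable fun t => 1 - tail μ Z (φ t) :=
    measurable_const.sub (tail_antitone.measurable.comp hφ)
  have h1 : ∫ t in Ioi a, -deriv (tail μ Y) t * (1 - tail μ Z (φ t)) =
      ∫ ω in A, (1 - tail μ Z (φ (Y ω).toReal)) ∂μ := by
    have := integral_map (μ := μ.restrict A) hY.ennreal_toReal.aemeasurable
      (f := fun t => 1 - tail μ Z (φ t)) hh.aestronglyMeasurable
    rw [← this, map_toReal_eq_withDensity hY hdY ha,
      integral_withDensity_eq_integral_smul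
        (f := fun t => (-deriv (tail μ Y) t).toNNReal) (measurable_deriv _).neg.real_toNNReal]
    refine integral_congr_ae (ae_of_all _ fun t => ?_)
    simp only [NNReal.smul_def, smul_eq_mul]
    rw [Real.coe_toNNReal _ (neg_nonneg.2 (tail_deriv_nonpos t))]
  have h2 : ∀ ω ∈ A, 1 - tail μ Z (φ (Y ω).toReal) =
      (μ {ω' | Z ω' < ENNReal.ofReal (φ (Y ω).toReal)}).toReal := by
    intro ω hω
    rw [← measure_lt_eq_one_sub_tail hZ hdZ (hφ0 _ ?_)]
    · rfl
    · refine ENNReal.toReal_pos (fun h => ?_) hω.2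
      have := hω.1
      rw [h] at this
      exact not_lt_bot this
  set S : Set (ℝ≥0∞ × ℝ≥0∞) :=
    {p | (ENNReal.ofReal a < p.1 ∧ p.1 ≠ ⊤) ∧ p.2 < ENNReal.ofReal (φ p.1.toReal)} with hS
  have hSm : MeasurableSet S := by
    refine MeasurableSet.inter ?_ (measurableSet_lt measurable_snd
      (hφ.comp measurable_fst.ennreal_toReal).ennreal_ofReal)
    exact (measurableSet_lt measurable_const measurable_fst).inter
      (measurable_fst (measurableSet_singleton ⊤)).compl
  -- By independence the joint law is a product, and Fubini integrates out `Z` for each frozen value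
  -- of `Y`.
  have h3 : μ {ω | (ENNReal.ofReal a < Y ω ∧ Y ω ≠ ⊤) ∧ Z ω < ENNReal.ofReal (φ (Y ω).toReal)} =
      ∫⁻ ω in A, μ {ω' | Z ω' < ENNReal.ofReal (φ (Y ω).toReal)} ∂μ := by
    have e := (indepFun_iff_map_prod_eq_prod_map_map hY.aemeasurable hZ.aemeasurable).1 hYZ
    have e2 : μ {ω | (ENNReal.ofReal a < Y ω ∧ Y ω ≠ ⊤) ∧ Z ω < ENNReal.ofReal (φ (Y ω).toReal)} =
        μ.map (fun ω => (Y ω, Z ω)) S := by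
      rw [Measure.map_apply (hY.prodMk hZ) hSm]; rfl
    rw [e2, e, Measure.prod_apply hSm,
      lintegral_map (measurable_measure_prodMk_left hSm) hY, ← lintegral_indicator hAm]
    refine lintegral_congr fun ω => ?_
    rw [Measure.map_apply hZ (measurable_prodMk_left hSm)]
    by_cases hω : ω ∈ A
    · rw [indicator_of_mem hω]
      congr 1
      ext ω'
      simp only [hS, mem_preimage, mem_ofPred_eq, and_iff_right_iff_imp]
      exact fun _ => hω
    · rw [indicator_of_notMem hω]
      convert measure_empty (μ := μ)
      ext ω'
      simp only [hS, mem_preimage, mem_ofPred_eq, mem_empty_iff_false, iff_false]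
      exact fun h => hω h.1
  rw [h1, setIntegral_congr_fun hAm h2, measureReal_def, h3, integral_toReal]
  · have hT : MeasurableSet {p : ℝ≥0∞ × ℝ≥0∞ | p.2 < ENNReal.ofReal (φ p.1.toReal)} :=
      measurableSet_lt measurable_snd (hφ.comp measurable_fst.ennreal_toReal).ennreal_ofReal
    refine Measurable.aemeasurable ?_
    convert (measurable_measure_prodMk_left (ν := μ.map Z) hT).comp hY using 1
    funext ω
    rw [Function.comp_apply, Measure.map_apply hZ (measurable_prodMk_left hT)]
    rfl
  · exact ae_of_all _ fun ω => measure_lt_top _ _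

end Tail

/-! ### Mixtures of scaled Gamma tails. -/

section GammaTail

lemma integrable_gammaPDFReal {a r : ℝ} (ha : 0 < a) (hr : 0 < r) :
    Integrable (gammaPDFReal a r) := by
  refine ⟨(measurable_gammaPDFReal a r).aestronglyMeasurable, ?_⟩
  rw [hasFiniteIntegral_iff_ofReal (ae_of_all _ fun x => gammaPDFReal_nonneg ha hr x)]
  have := lintegral_gammaPDF_eq_one ha hr
  simp only [gammaPDF] at this
  rw [this]
  exact ENNReal.one_lt_top

lemma continuousAt_gammaPDFReal (a r : ℝ) {x : ℝ} (hx : 0 < x) :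
    ContinuousAt (gammaPDFReal a r) x := by
  have h : ContinuousAt (fun x : ℝ => r ^ a / (Real.Gamma a) * x ^ (a - 1) * Real.exp (-(r * x))) x :=
    (continuousAt_const.mul (Real.continuousAt_rpow_const _ _ (Or.inl hx.ne'))).mul
      (by fun_prop)
  refine h.congr ?_
  filter_upwards [lt_mem_nhds hx] with y hy
  simp only [gammaPDFReal, if_pos hy.le]

lemma hasDerivAt_gammaMeasure_Ioi {a r : ℝ} (ha : 0 < a) (hr : 0 < r) {x : ℝ} (hx : 0 < x) :
    HasDerivAt (fun y => (gammaMeasure a r).real (Ioi y)) (-gammaPDFReal a r x) x := by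
  have := isProbabilityMeasure_gammaMeasure ha hr
  have hint := integrable_gammaPDFReal ha hr
  have e : ∀ y, (gammaMeasure a r).real (Ioi y) =
      1 - (∫ z in Iic (0 : ℝ), gammaPDFReal a r z) - ∫ z in (0 : ℝ)..y, gammaPDFReal a r z := by
    intro y
    rw [← compl_Iic, probReal_compl_eq_one_sub measurableSet_Iic, ← cdf_eq_real,
      cdf_gammaMeasure_eq_integral ha hr,
      ← intervalIntegral.integral_Iic_sub_Iic hint.integrableOn hint.integrableOn]
    ring
  simp only [e]
  exact (intervalIntegral.integral_hasDerivAt_right hint.intervalIntegrable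
    ((stronglyMeasurable_gammaPDFReal a r).stronglyMeasurableAtFilter)
    (continuousAt_gammaPDFReal a r hx)).const_sub _

/-- Since shape and rate coincide, `x p(x)` is a constant times `(x exp (-x)) ^ n`. The bound makes
the derivative of a scaled tail uniform in the scale. -/
lemma exists_mul_gammaPDFReal_le {n : ℕ} (hn : 0 < n) :
    ∃ C : ℝ, ∀ x, 0 < x → x * gammaPDFReal n n x ≤ C := by
  refine ⟨(n : ℝ) ^ (n : ℝ) / Real.Gamma n, fun x hx => ?_⟩
  have hG : 0 < Real.Gamma n := Real.Gamma_pos_of_pos (by exact_mod_cast hn)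
  have h1 : x * gammaPDFReal n n x =
      (n : ℝ) ^ (n : ℝ) / Real.Gamma n * (x * Real.exp (-x)) ^ n := by
    rw [gammaPDFReal, if_pos hx.le, Real.rpow_sub hx, Real.rpow_one, Real.rpow_natCast x n, mul_pow,
      ← Real.exp_nat_mul, mul_neg]
    field_simp
  have h2 : x * Real.exp (-x) ≤ 1 := by
    rw [Real.exp_neg, ← div_eq_mul_inv, div_le_one (Real.exp_pos x)]
    linarith [Real.add_one_le_exp x]
  rw [h1]
  exact mul_le_of_le_one_right (by positivity) (pow_le_one₀ (by positivity) h2)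

/-- The probability that a random factor with law `γ`, multiplied by `v`, exceeds `t`. -/
def scaledTail (γ : Measure ℝ) (v : ℝ≥0∞) (t : ℝ) : ℝ :=
  γ.real {x | ENNReal.ofReal t < v * ENNReal.ofReal x}

/-- For `v = 0` and `v = ⊤` the tail does not depend on the threshold, and the formula still gives
`0` because `v.toReal = 0` and division by zero is `0`. -/
lemma hasDerivAt_scaledTail {a r : ℝ} (ha : 0 < a) (hr : 0 < r) (v : ℝ≥0∞) {t : ℝ} (ht : 0 < t) :
    HasDerivAt (scaledTail (gammaMeasure a r) v)
      (-(gammaPDFReal a r (t / v.toReal) / v.toReal)) t := by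
  rcases eq_or_ne v ⊤ with rfl | hv
  · have : scaledTail (gammaMeasure a r) ⊤ = fun _ => (gammaMeasure a r).real (Ioi 0) := by
      funext s
      rw [scaledTail]
      congr 1
      ext x
      rcases le_or_gt x 0 with hx | hx
      · simp [ENNReal.ofReal_of_nonpos hx, hx]
      · simp [ENNReal.top_mul (ENNReal.ofReal_pos.2 hx).ne', hx]
    rw [this]
    simpa using hasDerivAt_const t _
  rcases eq_or_ne v 0 with rfl | hv0
  · have : scaledTail (gammaMeasure a r) 0 = fun _ => 0 := by
      funext s
      simp [scaledTail]
    rw [this]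
    simpa using hasDerivAt_const t (0 : ℝ)
  obtain ⟨c, hc⟩ : ∃ c, c = v.toReal := ⟨_, rfl⟩
  have hc0 : 0 < c := hc ▸ ENNReal.toReal_pos hv0 hv
  have hvc : v = ENNReal.ofReal c := by rw [hc, ENNReal.ofReal_toReal hv]
  rw [← hc, hvc]
  have h := (hasDerivAt_gammaMeasure_Ioi ha hr (div_pos ht hc0)).comp t
    ((hasDerivAt_id t).div_const c)
  have h' : HasDerivAt (fun s => (gammaMeasure a r).real (Ioi (s / c)))
      (-(gammaPDFReal a r (t / c) / c)) t := h.congr_deriv (by ring)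
  refine h'.congr_of_eventuallyEq ?_
  filter_upwards [lt_mem_nhds ht] with s hs
  rw [scaledTail]
  congr 1
  ext x
  rw [mem_ofPred_eq, ← ENNReal.ofReal_mul hc0.le, ENNReal.ofReal_lt_ofReal_iff_of_nonneg hs.le,
    mem_Ioi, div_lt_iff₀' hc0]

lemma measurable_scaledTail (γ : Measure ℝ) [SFinite γ] (t : ℝ) :
    Measurable fun v => γ {x | ENNReal.ofReal t < v * ENNReal.ofReal x} :=
  measurable_measure_prodMk_left (measurableSet_lt measurable_const
    (measurable_fst.mul measurable_snd.ennreal_ofReal))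

variable {Ω : Type*} [MeasurableSpace Ω] {μ : Measure Ω} [IsProbabilityMeasure μ]

/-- Differentiation under the integral sign. With `x = s / V` the derivative is `-(x p(x)) / s`, so
on `s > t / 2` the constant `C / (t / 2)` dominates it for every `V`. -/
lemma differentiableOn_integral_scaledTail {n : ℕ} (hn : 0 < n) {V : Ω → ℝ≥0∞}
    (hV : Measurable V) :
    DifferentiableOn ℝ (fun t => ∫ ω, scaledTail (gammaMeasure n n) (V ω) t ∂μ) (Ioi 0) := by
  have hn' : (0 : ℝ) < n := by exact_mod_cast hn
  have := isProbabilityMeasure_gammaMeasure hn' hn'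
  intro t ht
  rw [mem_Ioi] at ht
  obtain ⟨C, hC⟩ := exists_mul_gammaPDFReal_le hn
  have hm : ∀ s, Measurable fun ω => scaledTail (gammaMeasure n n) (V ω) s := fun s =>
    ((measurable_scaledTail (gammaMeasure n n) s).comp hV).ennreal_toReal
  have hC0 : 0 ≤ C :=
    (mul_nonneg zero_le_one (gammaPDFReal_nonneg hn' hn' 1)).trans (hC 1 one_pos)
  have key := hasDerivAt_integral_of_dominated_loc_of_deriv_le (μ := μ)
    (F := fun s ω => scaledTail (gammaMeasure n n) (V ω) s)
    (F' := fun s ω => -(gammaPDFReal n n (s / (V ω).toReal) / (V ω).toReal))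
    (bound := fun _ => C / (t / 2)) (s := Ioi (t / 2)) (x₀ := t)
    (Ioi_mem_nhds (by linarith)) (Eventually.of_forall fun s => (hm s).aestronglyMeasurable)
    (Integrable.of_bound (hm t).aestronglyMeasurable 1 (ae_of_all _ fun ω => ?_))
    ?_ (ae_of_all _ fun ω s hs => ?_) (integrable_const _)
    (ae_of_all _ fun ω s hs => hasDerivAt_scaledTail hn' hn' _ (by rw [mem_Ioi] at hs; linarith))
  · exact key.2.differentiableAt.differentiableWithinAt
  · rw [scaledTail, Real.norm_of_nonneg measureReal_nonneg]
    exact measureReal_le_one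
  · refine Measurable.aestronglyMeasurable ?_
    exact (((measurable_gammaPDFReal n n).comp
      (measurable_const.div hV.ennreal_toReal)).div hV.ennreal_toReal).neg
  · rw [mem_Ioi] at hs
    have hs0 : 0 < s := by linarith
    have hv : 0 ≤ (V ω).toReal := ENNReal.toReal_nonneg
    rw [norm_neg, Real.norm_of_nonneg (div_nonneg (gammaPDFReal_nonneg hn' hn' _) hv)]
    rcases hv.eq_or_lt with h0 | h0
    · rw [← h0, div_zero]
      positivity
    · have h1 := hC _ (div_pos hs0 h0)
      calc gammaPDFReal n n (s / (V ω).toReal) / (V ω).toReal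
          = s / (V ω).toReal * gammaPDFReal n n (s / (V ω).toReal) / s := by field_simp
        _ ≤ C / s := by gcongr
        _ ≤ C / (t / 2) := by gcongr

/-- If at most one of the factors `Z k` is nonzero, then the tail of `∑ k, Z k * g k` is a mixture
of scaled tails of the law of the `g k`. -/
lemma tail_tsum_mul_eq {γ : Measure ℝ} [IsProbabilityMeasure γ] {Z : ℕ → Ω → ℝ≥0∞}
    {g : ℕ → Ω → ℝ} (hZ : ∀ k, Measurable (Z k)) (hg : ∀ k, Measurable (g k))
    (hlaw : ∀ k, μ.map (g k) = γ) (hind : ∀ k, IndepFun (Z k) (g k) μ)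
    (hdisj : ∀ ω k l, k ≠ l → Z k ω = 0 ∨ Z l ω = 0) (t : ℝ) :
    tail μ (fun ω => ∑' k, Z k ω * ENNReal.ofReal (g k ω)) t =
      ∫ ω, scaledTail γ (∑' k, Z k ω) t ∂μ := by
  -- One index carries both sums; if all factors vanish, any index will do and `0` is taken.
  have hsum : ∀ ω, ∃ k, (∑' k, Z k ω = Z k ω) ∧
      (∑' k, Z k ω * ENNReal.ofReal (g k ω) = Z k ω * ENNReal.ofReal (g k ω)) ∧
      ∀ l ≠ k, Z l ω = 0 := by
    intro ω
    by_cases h : ∃ k, Z k ω ≠ 0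
    · obtain ⟨k, hk⟩ := h
      have hl : ∀ l ≠ k, Z l ω = 0 := fun l hl => (hdisj ω l k hl).resolve_right hk
      exact ⟨k, tsum_eq_single k hl, tsum_eq_single k fun l h => by rw [hl l h, zero_mul], hl⟩
    · push Not at h
      exact ⟨0, by simp [h], by simp [h], fun l _ => h l⟩
  have hS : MeasurableSet {p : ℝ≥0∞ × ℝ | ENNReal.ofReal t < p.1 * ENNReal.ofReal p.2} :=
    measurableSet_lt measurable_const (measurable_fst.mul measurable_snd.ennreal_ofReal)
  have hone : ∀ k, μ {ω | ENNReal.ofReal t < Z k ω * ENNReal.ofReal (g k ω)} =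
      ∫⁻ ω, γ {x | ENNReal.ofReal t < Z k ω * ENNReal.ofReal x} ∂μ := by
    intro k
    have e := (indepFun_iff_map_prod_eq_prod_map_map (hZ k).aemeasurable
      (hg k).aemeasurable).1 (hind k)
    have e2 : μ {ω | ENNReal.ofReal t < Z k ω * ENNReal.ofReal (g k ω)} =
        μ.map (fun ω => (Z k ω, g k ω))
          {p : ℝ≥0∞ × ℝ | ENNReal.ofReal t < p.1 * ENNReal.ofReal p.2} := by
      rw [Measure.map_apply ((hZ k).prodMk (hg k)) hS]; rfl
    rw [e2, e, Measure.prod_apply hS, lintegral_map (measurable_measure_prodMk_left hS) (hZ k),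
      hlaw k]
    rfl
  -- Splitting by the index of the nonzero factor reduces the claim to single products, so
  -- independence is needed only between `Z k` and `g k` with the same `k`.
  have hunion : {ω | ENNReal.ofReal t < ∑' k, Z k ω * ENNReal.ofReal (g k ω)} =
      ⋃ k, {ω | ENNReal.ofReal t < Z k ω * ENNReal.ofReal (g k ω)} := by
    ext ω
    obtain ⟨k, -, h2, h3⟩ := hsum ω
    simp only [mem_ofPred_eq, mem_iUnion]
    constructor
    · intro h
      exact ⟨k, h2 ▸ h⟩
    · rintro ⟨l, hl⟩
      exact hl.trans_le (ENNReal.le_tsum l)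
  have hpd : Pairwise (Function.onFun Disjoint
      fun k => {ω | ENNReal.ofReal t < Z k ω * ENNReal.ofReal (g k ω)}) := by
    intro k l hkl
    rw [Function.onFun, Set.disjoint_left]
    intro ω h1 h2
    rw [mem_ofPred_eq] at h1 h2
    rcases hdisj ω k l hkl with h | h
    · rw [h, zero_mul] at h1
      exact not_lt_bot h1
    · rw [h, zero_mul] at h2
      exact not_lt_bot h2
  have hγ : ∀ ω, ∑' k, γ {x | ENNReal.ofReal t < Z k ω * ENNReal.ofReal x} =
      γ {x | ENNReal.ofReal t < (∑' k, Z k ω) * ENNReal.ofReal x} := by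
    intro ω
    obtain ⟨k, h1, -, h3⟩ := hsum ω
    rw [h1, tsum_eq_single k]
    intro l hl
    simp [h3 l hl]
  have hm : Measurable fun ω => γ {x | ENNReal.ofReal t < (∑' k, Z k ω) * ENNReal.ofReal x} :=
    (measurable_scaledTail γ t).comp (Measurable.tsum hZ)
  simp only [scaledTail, measureReal_def]
  rw [tail, measureReal_def, hunion, measure_iUnion hpd (fun k => measurableSet_lt measurable_const
    ((hZ k).mul (hg k).ennreal_ofReal)), integral_toReal hm.aemeasurable
    (ae_of_all _ fun ω => measure_lt_top _ _)]
  simp only [hone]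
  have hswap := lintegral_tsum (μ := μ)
    fun k => ((measurable_scaledTail γ t).comp (hZ k)).aemeasurable
  simp only [Function.comp_apply, hγ] at hswap
  rw [hswap]

lemma differentiableOn_tail_tsum_mul {n : ℕ} (hn : 0 < n) {Z : ℕ → Ω → ℝ≥0∞}
    {g : ℕ → Ω → ℝ} (hZ : ∀ k, Measurable (Z k)) (hg : ∀ k, Measurable (g k))
    (hlaw : ∀ k, μ.map (g k) = gammaMeasure n n) (hind : ∀ k, IndepFun (Z k) (g k) μ)
    (hdisj : ∀ ω k l, k ≠ l → Z k ω = 0 ∨ Z l ω = 0) :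
    DifferentiableOn ℝ (tail μ fun ω => ∑' k, Z k ω * ENNReal.ofReal (g k ω)) (Ioi 0) := by
  have hn' : (0 : ℝ) < n := by exact_mod_cast hn
  have := isProbabilityMeasure_gammaMeasure hn' hn'
  refine (differentiableOn_integral_scaledTail (μ := μ) hn (V := fun ω => ∑' k, Z k ω)
    (Measurable.tsum hZ)).congr fun t _ => ?_
  exact tail_tsum_mul_eq hZ hg hlaw hind hdisj t

lemma gammaMeasure_Iic_zero (a r : ℝ) : gammaMeasure a r (Iic 0) = 0 := by
  rw [gammaMeasure, withDensity_apply _ measurableSet_Iic, setLIntegral_congr Iio_ae_eq_Iic.symm]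
  exact lintegral_gammaPDF_of_nonpos le_rfl

end GammaTail

/-! ### Elementary properties of path loss, array gain and fading parameter. -/

lemma HetNetParams.measurable_pathLoss (par : HetNetParams) (i : Tier) :
    Measurable (par.pathLoss i) := by
  cases i with
  | macroBS => exact (measurable_id.pow_const _).const_mul _
  | picoBS =>
    refine Measurable.mul (Measurable.ite ?_ measurable_const measurable_const)
      ((measurable_id.pow_const _).const_mul _)
    exact measurableSet_le measurable_const (measurable_const.sub measurable_id)

lemma HetNetParams.measurable_arrayGain (par : HetNetParams) (i : Tier) :
    Measurable (par.arrayGain i) := by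
  cases i with
  | macroBS => exact measurable_const
  | picoBS =>
    refine Measurable.ite ?_ measurable_const ?_
    · exact (by fun_prop : Measurable fun w => Real.sin (Real.pi * w)) (measurableSet_singleton 0)
    · fun_prop

lemma HetNetParams.pathLoss_nonneg (par : HetNetParams) (i : Tier) {r : ℝ} (hr : 0 ≤ r) :
    0 ≤ par.pathLoss i r := by
  have h := fun i => mul_nonneg (par.intercept_pos i).le (Real.rpow_nonneg hr (-par.exponent i))
  cases i with
  | macroBS => exact h _
  | picoBS =>
    refine mul_nonneg ?_ (h _)
    unfold unitStep
    split_ifs <;> norm_num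

lemma HetNetParams.fadingParam_pos (par : HetNetParams) (i : Tier) : 0 < par.fadingParam i := by
  cases i with
  | macroBS => exact one_pos
  | picoBS => exact par.nakagami_pos

namespace HetNet

/-! ### Measurability of interference and SINR. -/

section Measurability

variable {Ω : Type*} [MeasurableSpace Ω] {net : HetNet Ω} {par : HetNetParams} {i : Tier}

/-- The hypotheses are minimal so that small σ-algebras qualify. The fading of BS `k` is left out,
which later yields independence from it. The gains are assumed measurable rather than the angles,
because the constant macro gain must not bring in the angles, a pico source. -/
lemma measurable_interference {k : ℕ} (hloc : ∀ n, Measurable (net.loc i n))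
    (hfad : ∀ n ≠ k, Measurable (net.fading i n))
    (hgain : ∀ n, Measurable fun ω => par.arrayGain i (net.angle n ω)) :
    Measurable (net.interference par i k) := by
  refine Measurable.tsum fun n => ?_
  by_cases h : n = k
  · simp only [h, if_true]
    exact measurable_const
  · simp only [h, if_false]
    exact ((((par.measurable_pathLoss i).comp (hloc n).norm).const_mul _).mul
      (((hfad n h).const_mul _).mul (hgain n))).ennreal_ofReal

lemma measurable_sinrFrom {k : ℕ} (hloc : ∀ n, Measurable (net.loc i n))
    (hfad : ∀ n, Measurable (net.fading i n))
    (hgain : ∀ n, Measurable fun ω => par.arrayGain i (net.angle n ω)) :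
    Measurable (net.sinrFrom par i k) :=
  ((((par.measurable_pathLoss i).comp (hloc k).norm).const_mul _).mul
    ((hfad k).const_mul _)).ennreal_ofReal.div
    (measurable_const.add (measurable_interference hloc (fun n _ => hfad n) hgain))

end Measurability

/-! ### The SINR as a sum of fading powers times factors of which at most one is nonzero. -/

section ServingFactor

variable {Ω : Type*}

/-- BS `k` of tier `i` is the nearest one of the tier that stores `f`. -/
def Serves (net : HetNet Ω) (i : Tier) (f k : ℕ) (ω : Ω) : Prop :=
  f ∈ net.cache i k ω ∧ ∀ l < k, f ∉ net.cache i l ω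

open Classical in
/-- The SINR for file `f` from tier `i`, divided by the fading power of the serving BS, if this
is BS `k`. -/
noncomputable def servingFactor (net : HetNet Ω) (par : HetNetParams) (i : Tier) (f k : ℕ) (ω : Ω) : ℝ≥0∞ :=
  if net.Serves i f k ω then
    ENNReal.ofReal (par.power i * par.pathLoss i ‖net.loc i k ω‖ * par.antennas i)
      / (ENNReal.ofReal (par.noise i) + net.interference par i k ω)
  else 0

variable {net : HetNet Ω} {par : HetNetParams} {i : Tier}

lemma Serves.eq {f k l : ℕ} {ω : Ω} (hk : net.Serves i f k ω) (hl : net.Serves i f l ω) :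
    k = l := by
  rcases lt_trichotomy k l with h | h | h
  · exact absurd hk.1 (hl.2 k h)
  · exact h
  · exact absurd hl.1 (hk.2 l h)

lemma exists_serves {f n : ℕ} {ω : Ω} (h : f ∈ net.cache i n ω) : ∃ k, net.Serves i f k ω := by
  classical
  have h' : ∃ n, f ∈ net.cache i n ω := ⟨n, h⟩
  exact ⟨Nat.find h', Nat.find_spec h', fun l hl => Nat.find_min h' hl⟩

lemma Serves.sinr_eq {f k : ℕ} {ω : Ω} (h : net.Serves i f k ω) :
    net.sinr par i f ω = net.sinrFrom par i k ω := by
  have hs : sInf {n | f ∈ net.cache i n ω} = k :=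
    le_antisymm (Nat.sInf_le h.1) (le_csInf ⟨k, h.1⟩ fun n hn => not_lt.1 fun hlt => h.2 n hlt hn)
  rw [sinr, if_pos ⟨k, h.1⟩, hs]

lemma servingFactor_eq_zero_or {f k l : ℕ} (ω : Ω) (hkl : k ≠ l) :
    net.servingFactor par i f k ω = 0 ∨ net.servingFactor par i f l ω = 0 := by
  by_cases hk : net.Serves i f k ω
  · exact Or.inr (if_neg fun hl => hkl (hk.eq hl))
  · exact Or.inl (if_neg hk)

lemma sinr_eq_tsum (net : HetNet Ω) (par : HetNetParams) (i : Tier) (f : ℕ) :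
    net.sinr par i f =
      fun ω => ∑' k, net.servingFactor par i f k ω * ENNReal.ofReal (net.fading i k ω) := by
  funext ω
  by_cases h : ∃ n, f ∈ net.cache i n ω
  · obtain ⟨n, hn⟩ := h
    obtain ⟨k, hk⟩ := exists_serves hn
    rw [hk.sinr_eq, tsum_eq_single k]
    · rw [servingFactor, if_pos hk, sinrFrom, ← mul_assoc, ENNReal.ofReal_mul, div_eq_mul_inv,
        div_eq_mul_inv]
      · ring
      · exact mul_nonneg (mul_nonneg (par.power_pos i).le
          (par.pathLoss_nonneg i (norm_nonneg _))) (Nat.cast_nonneg _)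
    · intro l hl
      rw [servingFactor, if_neg fun hl' => hl (hl'.eq hk), zero_mul]
  · rw [sinr, if_neg h]
    symm
    rw [ENNReal.tsum_eq_zero]
    intro k
    rw [servingFactor, if_neg fun hk => h ⟨k, hk.1⟩, zero_mul]

lemma measurable_servingFactor [MeasurableSpace Ω] {f k : ℕ}
    (hloc : ∀ n, Measurable (net.loc i n)) (hfad : ∀ n ≠ k, Measurable (net.fading i n))
    (hgain : ∀ n, Measurable fun ω => par.arrayGain i (net.angle n ω))
    (hcache : ∀ n, Measurable (net.cache i n)) : Measurable (net.servingFactor par i f k) := by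
  have hm : ∀ n, MeasurableSet {ω | f ∈ net.cache i n ω} := fun n =>
    measurableSet_setOfPred.2 ((measurable_set_mem f).comp (hcache n))
  refine Measurable.ite ?_ ?_ measurable_const
  · refine (hm k).inter ?_
    have : {ω | ∀ l < k, f ∉ net.cache i l ω} = ⋂ l, ⋂ (_ : l < k), {ω | f ∈ net.cache i l ω}ᶜ := by
      ext ω
      simp
    change MeasurableSet {ω | ∀ l < k, f ∉ net.cache i l ω}
    rw [this]
    exact MeasurableSet.iInter fun l => MeasurableSet.iInter fun _ => (hm l).compl
  · exact ((((par.measurable_pathLoss i).comp (hloc k).norm).const_mul _).mul_const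
      _).ennreal_ofReal.div (measurable_const.add (measurable_interference hloc hfad hgain))

lemma measurable_sinr_of [MeasurableSpace Ω] {f : ℕ} (hloc : ∀ n, Measurable (net.loc i n))
    (hfad : ∀ n, Measurable (net.fading i n))
    (hgain : ∀ n, Measurable fun ω => par.arrayGain i (net.angle n ω))
    (hcache : ∀ n, Measurable (net.cache i n)) : Measurable (net.sinr par i f) := by
  rw [sinr_eq_tsum]
  exact Measurable.tsum fun k => (measurable_servingFactor hloc (fun n _ => hfad n) hgain
    hcache).mul (hfad k).ennreal_ofReal

end ServingFactor

/-- The tier that a source of randomness belongs to; the angles belong to the pico tier. -/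
def _root_.Source.tier : Source → Option Tier
  | .request => none
  | .location i => some i
  | .fading i _ => some i
  | .angle _ => some .picoBS
  | .cache i _ => some i

/-! ### Which sources of randomness the SINRs depend on. -/

section Sources

variable {Ω : Type*} {net : HetNet Ω} {par : HetNetParams} {i : Tier} {S : Set Source}

/-- The σ-algebra generated by a set of sources of randomness. -/
@[reducible] def sourcesAlgebra (net : HetNet Ω) (S : Set Source) : MeasurableSpace Ω :=
  ⨆ s ∈ S, net.sourceAlgebra s

lemma sourceAlgebra_le_sourcesAlgebra {s : Source} (hs : s ∈ S) :
    net.sourceAlgebra s ≤ net.sourcesAlgebra S := le_iSup₂_of_le s hs le_rfl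

lemma measurable_request_sources (h : Source.request ∈ S) :
    Measurable[net.sourcesAlgebra S] net.request :=
  (comap_measurable net.request).mono (sourceAlgebra_le_sourcesAlgebra h) le_rfl

lemma measurable_loc_sources (h : Source.location i ∈ S) (n : ℕ) :
    Measurable[net.sourcesAlgebra S] (net.loc i n) :=
  ((measurable_pi_apply n).comp (comap_measurable fun ω n => net.loc i n ω)).mono
    (sourceAlgebra_le_sourcesAlgebra h) le_rfl

lemma measurable_fading_sources {n : ℕ} (h : Source.fading i n ∈ S) :
    Measurable[net.sourcesAlgebra S] (net.fading i n) :=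
  (comap_measurable (net.fading i n)).mono (sourceAlgebra_le_sourcesAlgebra h) le_rfl

lemma measurable_cache_sources {n : ℕ} (h : Source.cache i n ∈ S) :
    Measurable[net.sourcesAlgebra S] (net.cache i n) :=
  (comap_measurable (net.cache i n)).mono (sourceAlgebra_le_sourcesAlgebra h) le_rfl

lemma measurable_gain_sources {n : ℕ} (h : i = .picoBS → Source.angle n ∈ S) :
    Measurable[net.sourcesAlgebra S] fun ω => par.arrayGain i (net.angle n ω) := by
  cases i with
  | macroBS => exact measurable_const
  | picoBS =>
    exact ((par.measurable_arrayGain .picoBS).comp (comap_measurable (net.angle n))).mono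
      (sourceAlgebra_le_sourcesAlgebra (h rfl)) le_rfl

lemma measurable_sinr_sources (hS : ∀ s : Source, s.tier = some i → s ∈ S) (f : ℕ) :
    Measurable[net.sourcesAlgebra S] (net.sinr par i f) :=
  @measurable_sinr_of Ω net par i (net.sourcesAlgebra S) f
    (measurable_loc_sources (hS _ rfl)) (fun _ => measurable_fading_sources (hS _ rfl))
    (fun _ => measurable_gain_sources fun hi => hS _ (by rw [hi]; rfl))
    (fun _ => measurable_cache_sources (hS _ rfl))

lemma measurable_serverSinr_sources (hS : ∀ s : Source, s.tier = some .macroBS → s ∈ S) :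
    Measurable[net.sourcesAlgebra S] (net.serverSinr par) :=
  @measurable_sinrFrom Ω (net.sourcesAlgebra S) net par .macroBS 0
    (measurable_loc_sources (hS _ rfl)) (fun _ => measurable_fading_sources (hS _ rfl))
    (fun _ => measurable_gain_sources fun hi => hS _ (by rw [hi]; rfl))

end Sources

/-! ### Measurability and independence of families of sources in the model. -/

namespace IsModel

variable {Ω : Type*} [MeasurableSpace Ω] {μ : Measure Ω} {net : HetNet Ω}
  {par : HetNetParams}

lemma sourceAlgebra_le (hnet : net.IsModel par μ) (s : Source) : net.sourceAlgebra s ≤ ‹MeasurableSpace Ω› := by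
  cases s with
  | request => exact hnet.measurable_request.comap_le
  | location i => exact (measurable_pi_lambda _ (hnet.law_location i).measurable).comap_le
  | fading i n => exact (hnet.measurable_fading i n).comap_le
  | angle n => exact (hnet.measurable_angle n).comap_le
  | cache i n => exact (hnet.measurable_cache i n).comap_le

lemma sourcesAlgebra_le (hnet : net.IsModel par μ) (S : Set Source) : net.sourcesAlgebra S ≤ ‹MeasurableSpace Ω› :=
  iSup₂_le fun s _ => hnet.sourceAlgebra_le s

lemma indep_sourcesAlgebra (hnet : net.IsModel par μ) {S T : Set Source} (h : Disjoint S T) :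
    Indep (net.sourcesAlgebra S) (net.sourcesAlgebra T) μ :=
  indep_iSup_of_disjoint hnet.sourceAlgebra_le hnet.indep h

lemma measurable_sinr (hnet : net.IsModel par μ) (i : Tier) (f : ℕ) : Measurable (net.sinr par i f) :=
  (measurable_sinr_sources (S := univ) (fun _ _ => mem_univ _) f).mono
    (hnet.sourcesAlgebra_le univ) le_rfl

lemma measurable_serverSinr (hnet : net.IsModel par μ) : Measurable (net.serverSinr par) :=
  (measurable_serverSinr_sources (S := univ) fun _ _ => mem_univ _).mono
    (hnet.sourcesAlgebra_le univ) le_rfl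

end IsModel
end HetNet

lemma Tier.other_ne (i : Tier) : i.other ≠ i := by
  cases i <;> simp [Tier.other]

/-- The origin has area zero, so its count is Poisson with parameter `0`. It has to be excluded
since `0 ^ (-α)` is `0` for real powers with `α > 0`, so a BS at the origin would have no path loss
gain at all. -/
lemma IsPoissonProcess.ae_ne_zero {Ω : Type*} [MeasurableSpace Ω] {μ : Measure Ω}
    [IsProbabilityMeasure μ] {dens : ℝ} {X : ℕ → Ω → Plane} (h : IsPoissonProcess μ dens X) :
    ∀ᵐ ω ∂μ, ∀ n, X n ω ≠ 0 := by
  have h0 := h.law_count {0} (measurableSet_singleton _) (by simp) 0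
  have hp : poissonMeasure (dens * volume.real ({0} : Set Plane)).toNNReal {0} = 1 := by
    rw [poissonMeasure_singleton]
    simp [measureReal_def]
  rw [hp] at h0
  have hm : MeasurableSet {ω | {n | X n ω ∈ ({0} : Set Plane)}.encard = ((0 : ℕ) : ℕ∞)} := by
    have : {ω | {n | X n ω ∈ ({0} : Set Plane)}.encard = ((0 : ℕ) : ℕ∞)} =
        ⋂ n, (X n ⁻¹' {0})ᶜ := by
      ext ω
      simp [Set.eq_empty_iff_forall_notMem]
    rw [this]
    exact MeasurableSet.iInter fun n => (h.measurable n (measurableSet_singleton _)).compl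
  have hae := (mem_ae_iff_prob_eq_one hm).2 h0
  filter_upwards [hae] with ω hω n hn
  simp only [Nat.cast_zero, encard_eq_zero] at hω
  exact (Set.eq_empty_iff_forall_notMem.1 hω n) hn

/-! ### Differentiability of the coverage, independence of the tiers, almost sure positivity. -/

namespace HetNet.IsModel

variable {Ω : Type*} [MeasurableSpace Ω] {μ : Measure Ω} {net : HetNet Ω}
  {par : HetNetParams}

lemma differentiableOn_coverage [IsProbabilityMeasure μ] (hnet : net.IsModel par μ) (i : Tier) (f : ℕ) :
    DifferentiableOn ℝ (tail μ (net.sinr par i f)) (Ioi 0) := by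
  rw [sinr_eq_tsum]
  -- The factor of BS `k` is a function of all sources except the fading of BS `k`, hence
  -- independent of that fading.
  have hsrc : ∀ k, Measurable[net.sourcesAlgebra {s | s ≠ Source.fading i k}]
      (net.servingFactor par i f k) := fun k =>
    @measurable_servingFactor Ω net par i
      (net.sourcesAlgebra {s | s ≠ Source.fading i k}) f k
      (measurable_loc_sources (by simp))
      (fun n hn => measurable_fading_sources (by simpa using hn))
      (fun n => measurable_gain_sources fun _ => by simp)
      (fun n => measurable_cache_sources (by simp))
  refine differentiableOn_tail_tsum_mul (par.fadingParam_pos i)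
    (fun k => (hsrc k).mono (hnet.sourcesAlgebra_le _) le_rfl) (hnet.measurable_fading i)
    (hnet.law_fading i) (fun k => ?_) (fun ω k l => servingFactor_eq_zero_or ω)
  rw [IndepFun_iff_Indep]
  have hd : Disjoint {s | s ≠ Source.fading i k} {Source.fading i k} := by simp
  refine indep_of_indep_of_le_left (indep_of_indep_of_le_right (hnet.indep_sourcesAlgebra hd) ?_)
    (hsrc k).comap_le
  exact sourceAlgebra_le_sourcesAlgebra (net := net) (mem_singleton (Source.fading i k))

lemma indepFun_sinr (hnet : net.IsModel par μ) (i : Tier) (f : ℕ) :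
    IndepFun (net.sinr par i f) (net.sinr par i.other f) μ := by
  rw [IndepFun_iff_Indep]
  have hd : Disjoint {s : Source | s.tier = some i} {s : Source | s.tier = some i.other} := by
    rw [Set.disjoint_left]
    intro s h1 h2
    rw [mem_ofPred_eq] at h1 h2
    rw [h1] at h2
    exact i.other_ne (Option.some.inj h2).symm
  exact indep_of_indep_of_le_left (indep_of_indep_of_le_right (hnet.indep_sourcesAlgebra hd)
    (measurable_sinr_sources (fun _ h => h) f).comap_le)
    (measurable_sinr_sources (fun _ h => h) f).comap_le

lemma ae_fading_pos (hnet : net.IsModel par μ) : ∀ᵐ ω ∂μ, ∀ i n, 0 < net.fading i n ω := by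
  refine ae_all_iff.2 fun i => ae_all_iff.2 fun n => ?_
  have h : μ (net.fading i n ⁻¹' Iic 0) = 0 := by
    rw [← Measure.map_apply (hnet.measurable_fading i n) measurableSet_Iic, hnet.law_fading i n]
    exact gammaMeasure_Iic_zero _ _
  filter_upwards [measure_eq_zero_iff_ae_notMem.1 h] with ω hω
  simpa using hω

/-- The gain can vanish only at zeros of `sin (π N w)`, a countable set, which the uniform angle
avoids almost surely. -/
lemma ae_arrayGain_pos (hnet : net.IsModel par μ) :
    ∀ᵐ ω ∂μ, ∀ i n, 0 < par.arrayGain i (net.angle n ω) := by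
  refine ae_all_iff.2 fun i => ae_all_iff.2 fun n => ?_
  cases i with
  | macroBS => exact ae_of_all _ fun _ => one_pos
  | picoBS =>
    have hN : (0 : ℝ) < par.antennas .picoBS := by exact_mod_cast par.antennas_pos .picoBS
    have hc : {w : ℝ | Real.sin (Real.pi * par.antennas .picoBS * w) = 0}.Countable := by
      refine (countable_range fun z : ℤ => (z : ℝ) / par.antennas .picoBS).mono fun w hw => ?_
      obtain ⟨z, hz⟩ := Real.sin_eq_zero_iff.1 hw
      refine ⟨z, ?_⟩
      have : Real.pi * z = Real.pi * (par.antennas .picoBS * w) := by linarith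
      simp only
      rw [mul_left_cancel₀ Real.pi_ne_zero this]
      field_simp
    have h : μ (net.angle n ⁻¹' {w : ℝ | Real.sin (Real.pi * par.antennas .picoBS * w) = 0}) = 0 := by
      rw [← Measure.map_apply (hnet.measurable_angle n) hc.measurableSet]
      exact (hnet.law_angle n).absolutelyContinuous (hc.measure_zero _)
    filter_upwards [measure_eq_zero_iff_ae_notMem.1 h] with ω hω
    rw [mem_preimage, mem_ofPred_eq] at hω
    simp only [HetNetParams.arrayGain]
    split_ifs with h0
    · exact one_pos
    · positivity

lemma ae_loc_ne_zero [IsProbabilityMeasure μ] (hnet : net.IsModel par μ) :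
    ∀ᵐ ω ∂μ, ∀ i n, net.loc i n ω ≠ 0 :=
  ae_all_iff.2 fun i => (hnet.law_location i).ae_ne_zero

end HetNet.IsModel

/-! ### When the SINR is infinite. -/

namespace HetNet

variable {Ω : Type*} {net : HetNet Ω} {par : HetNetParams}

lemma sinr_ne_top_of_noise {i : Tier} (h : 0 < par.noise i) (f : ℕ) (ω : Ω) :
    net.sinr par i f ω ≠ ⊤ := by
  rw [sinr]
  split_ifs
  · refine ENNReal.div_ne_top ENNReal.ofReal_ne_top fun h0 => ?_
    exact (ENNReal.ofReal_pos.2 h).ne' (add_eq_zero.1 h0).1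
  · exact ENNReal.zero_ne_top

lemma interference_eq_zero_iff {i : Tier} {k : ℕ} {ω : Ω}
    (hfad : ∀ n, 0 < net.fading i n ω) (hgain : ∀ n, 0 < par.arrayGain i (net.angle n ω)) :
    net.interference par i k ω = 0 ↔ ∀ n ≠ k, par.pathLoss i ‖net.loc i n ω‖ = 0 := by
  rw [interference, ENNReal.tsum_eq_zero]
  refine forall_congr' fun n => ?_
  by_cases h : n = k
  · simp [h]
  · have hN : (0 : ℝ) < par.antennas i := by exact_mod_cast par.antennas_pos i
    have hP := par.power_pos i
    have h1 := par.pathLoss_nonneg i (norm_nonneg (net.loc i n ω))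
    have h2 := mul_pos (mul_pos hN (hfad n)) (hgain n)
    simp only [h, if_false, ENNReal.ofReal_eq_zero, ne_eq, not_false_eq_true, forall_const]
    constructor
    · intro h'
      refine le_antisymm (not_lt.1 fun hpos => ?_) h1
      exact absurd (mul_pos (mul_pos hP hpos) h2) (not_lt.2 h')
    · intro h'
      simp [h']

lemma pathLoss_macroBS_pos {r : ℝ} (hr : 0 < r) : 0 < par.pathLoss .macroBS r :=
  mul_pos (par.intercept_pos _) (Real.rpow_pos_of_pos hr _)

lemma pathLoss_pico_eq_zero_iff {r : ℝ} (hr : 0 < r) :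
    par.pathLoss .picoBS r = 0 ↔ par.losRadius < r := by
  have h : 0 < par.intercept .picoBS * r ^ (-par.exponent .picoBS) :=
    mul_pos (par.intercept_pos _) (Real.rpow_pos_of_pos hr _)
  simp only [HetNetParams.pathLoss, unitStep, mul_eq_zero, h.ne', or_false]
  split_ifs with h0
  · simp only [one_ne_zero, false_iff, not_lt]
    linarith
  · simp only [true_iff]
    linarith

end HetNet

namespace HetNet.IsModel

variable {Ω : Type*} [MeasurableSpace Ω] {μ : Measure Ω} [IsProbabilityMeasure μ] {net : HetNet Ω}
  {par : HetNetParams}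

lemma ae_sinr_macroBS_ne_top (hnet : net.IsModel par μ) (f : ℕ) :
    ∀ᵐ ω ∂μ, net.sinr par .macroBS f ω ≠ ⊤ := by
  filter_upwards [hnet.ae_fading_pos, hnet.ae_arrayGain_pos, hnet.ae_loc_ne_zero] with ω h1 h2 h3
  rw [sinr]
  split_ifs
  · refine ENNReal.div_ne_top ENNReal.ofReal_ne_top fun h0 => ?_
    set k := sInf {n | f ∈ net.cache .macroBS n ω}
    -- The tier is an infinite sequence, so BS `k + 1` exists and interferes; any index other than
    -- `k` would do.
    have := (interference_eq_zero_iff (h1 _) (h2 _)).1 (add_eq_zero.1 h0).2 (k + 1) (by simp)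
    exact (pathLoss_macroBS_pos (norm_pos_iff.2 (h3 _ _))).ne' this
  · exact ENNReal.zero_ne_top

/-- Without noise, the pico tier offers an infinite SINR for `f` iff its only BS within
line of sight stores `f`. -/
lemma ae_sinr_pico_eq_top_iff (hnet : net.IsModel par μ) (h0 : par.noise .picoBS = 0) (f : ℕ) :
    ∀ᵐ ω ∂μ, net.sinr par .picoBS f ω = ⊤ ↔ f ∈ net.cache .picoBS 0 ω ∧
      {n | net.loc .picoBS n ω ∈ Metric.closedBall 0 par.losRadius}.encard = 1 := by
  filter_upwards [hnet.ae_fading_pos, hnet.ae_arrayGain_pos, hnet.ae_loc_ne_zero,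
    (hnet.law_location .picoBS).sorted] with ω h1 h2 h3 h4
  have hball : ∀ n, n ∈ {n | net.loc .picoBS n ω ∈ Metric.closedBall 0 par.losRadius} ↔
      ‖net.loc .picoBS n ω‖ ≤ par.losRadius := fun n => by simp
  have hint : ∀ k, net.interference par .picoBS k ω = 0 ↔
      ∀ n ≠ k, par.losRadius < ‖net.loc .picoBS n ω‖ := by
    intro k
    rw [interference_eq_zero_iff (h1 _) (h2 _)]
    refine forall_congr' fun n => imp_congr_right fun _ => ?_
    exact pathLoss_pico_eq_zero_iff (norm_pos_iff.2 (h3 _ _))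
  have hsig : ∀ k, par.power .picoBS * par.pathLoss .picoBS ‖net.loc .picoBS k ω‖
      * (par.antennas .picoBS * net.fading .picoBS k ω) ≤ 0 ↔
        par.losRadius < ‖net.loc .picoBS k ω‖ := by
    intro k
    have hN : (0 : ℝ) < par.antennas .picoBS := by exact_mod_cast par.antennas_pos .picoBS
    rw [← pathLoss_pico_eq_zero_iff (par := par) (norm_pos_iff.2 (h3 _ _))]
    constructor
    · intro h
      refine le_antisymm (not_lt.1 fun hpos => ?_) (par.pathLoss_nonneg _ (norm_nonneg _))
      exact absurd (mul_pos (mul_pos (par.power_pos .picoBS) hpos) (mul_pos hN (h1 .picoBS k)))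
        (not_lt.2 h)
    · intro h
      simp [h]
  have htop : ∀ k, net.sinrFrom par .picoBS k ω = ⊤ ↔
      ‖net.loc .picoBS k ω‖ ≤ par.losRadius ∧
        ∀ n ≠ k, par.losRadius < ‖net.loc .picoBS n ω‖ := by
    intro k
    rw [sinrFrom, h0, ENNReal.ofReal_zero, zero_add, ENNReal.div_eq_top, hint, ne_eq,
      ENNReal.ofReal_eq_zero, hsig]
    simp
  constructor
  · intro h
    by_cases hex : ∃ n, f ∈ net.cache .picoBS n ω
    · obtain ⟨n, hn⟩ := hex
      obtain ⟨k, hk⟩ := exists_serves hn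
      rw [hk.sinr_eq, htop] at h
      -- BS `0` is at least as near as BS `k`, so it is in the ball as well. Thus the condition
      -- concerns the cache of the fixed index `0`, which is independent of the locations.
      have hk0 : k = 0 := by
        by_contra hne
        exact absurd ((h4 (Nat.zero_le k)).trans h.1) (not_le.2 (h.2 0 (Ne.symm hne)))
      subst hk0
      refine ⟨hk.1, encard_eq_one.2 ⟨0, ?_⟩⟩
      ext m
      rw [hball, mem_singleton_iff]
      refine ⟨fun hm => ?_, fun hm => hm ▸ h.1⟩
      by_contra hne
      exact absurd hm (not_le.2 (h.2 m hne))
    · rw [sinr, if_neg hex] at h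
      exact absurd h ENNReal.zero_ne_top
  · rintro ⟨hf, hc⟩
    have hk : net.Serves .picoBS f 0 ω := ⟨hf, fun l hl => absurd hl (Nat.not_lt_zero l)⟩
    obtain ⟨m, hm⟩ := encard_eq_one.1 hc
    have hm' : ∀ n, ‖net.loc .picoBS n ω‖ ≤ par.losRadius ↔ n = m := fun n => by
      rw [← hball, hm, mem_singleton_iff]
    have hm0 : 0 = m := (hm' 0).1 ((h4 (Nat.zero_le m)).trans ((hm' m).2 rfl))
    rw [hk.sinr_eq, htop]
    refine ⟨(hm' 0).2 hm0, fun n hn => not_le.1 fun hle => hn ?_⟩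
    rw [(hm' n).1 hle, hm0]

/-- The cache of BS `0` is independent of the locations, and a Poisson variable with mean `m`, here
`m = π λ R²`, equals `1` with probability `m exp (-m)`. -/
lemma measure_sinr_pico_eq_top (hnet : net.IsModel par μ) (h0 : par.noise .picoBS = 0) {f : ℕ}
    (hf : f ∈ Finset.Icc 1 par.numCached) :
    μ.real {ω | net.sinr par .picoBS f ω = ⊤} = par.cacheProb .picoBS f *
      (Real.pi * par.density .picoBS * par.losRadius ^ 2 *
        Real.exp (-(Real.pi * par.density .picoBS * par.losRadius ^ 2))) := by
  set B : Set Plane := Metric.closedBall 0 par.losRadius with hB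
  have hBm : MeasurableSet B := Metric.isClosed_closedBall.measurableSet
  have hR := par.losRadius_pos
  have hvol : volume B = ENNReal.ofReal (par.losRadius ^ 2 * Real.pi) := by
    rw [hB, EuclideanSpace.volume_closedBall_fin_two, ← ENNReal.ofReal_pow hR.le,
      ← ENNReal.ofReal_mul (by positivity)]
  have hcount := (hnet.law_location .picoBS).law_count B hBm (by rw [hvol]; exact ENNReal.ofReal_ne_top) 1
  have hd := par.density_pos .picoBS
  have hpos : 0 ≤ par.density .picoBS * (par.losRadius ^ 2 * Real.pi) := by positivity
  rw [measureReal_def, hvol, ENNReal.toReal_ofReal (by positivity), poissonMeasure_singleton,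
    Real.coe_toNNReal _ hpos] at hcount
  have hcaching := hnet.law_cache .picoBS 0 f hf
  have hI := hnet.indep_sourcesAlgebra (S := {Source.cache .picoBS 0})
    (T := {Source.location .picoBS}) (by simp)
  have hm1 : MeasurableSet[net.sourcesAlgebra {Source.cache .picoBS 0}]
      {ω | f ∈ net.cache .picoBS 0 ω} :=
    measurable_cache_sources (mem_singleton _)
      (measurableSet_setOfPred.2 (measurable_set_mem f) : MeasurableSet {s : Set ℕ | f ∈ s})
  have hm2 : MeasurableSet[net.sourcesAlgebra {Source.location .picoBS}]
      {ω | {n | net.loc .picoBS n ω ∈ B}.encard = ((1 : ℕ) : ℕ∞)} := by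
    -- Naming the single index in the ball expresses the count by countably many location events.
    have e : {ω | {n | net.loc .picoBS n ω ∈ B}.encard = ((1 : ℕ) : ℕ∞)} =
        ⋃ m, ⋂ n, {ω | net.loc .picoBS n ω ∈ B ↔ n = m} := by
      ext ω
      simp only [mem_ofPred_eq, Nat.cast_one, encard_eq_one, mem_iUnion, mem_iInter, Set.ext_iff,
        mem_singleton_iff]
    rw [e]
    refine MeasurableSet.iUnion fun m => MeasurableSet.iInter fun n => ?_
    have hmB : MeasurableSet[net.sourcesAlgebra {Source.location .picoBS}]
        (net.loc .picoBS n ⁻¹' B) := measurable_loc_sources (mem_singleton _) n hBm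
    by_cases h : n = m
    · simp only [h, iff_true]
      exact h ▸ hmB
    · simp only [h, iff_false]
      exact hmB.compl
  have hprod := (Indep_iff _ _ μ).1 hI _ _ hm1 hm2
  have hae : {ω | net.sinr par .picoBS f ω = ⊤} =ᵐ[μ] ({ω | f ∈ net.cache .picoBS 0 ω} ∩
      {ω | {n | net.loc .picoBS n ω ∈ B}.encard = ((1 : ℕ) : ℕ∞)} : Set Ω) := by
    filter_upwards [hnet.ae_sinr_pico_eq_top_iff h0 f] with ω hω
    exact propext hω
  rw [measureReal_congr hae, measureReal_def, hprod, hcaching, hcount, ENNReal.toReal_mul,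
    ENNReal.toReal_ofReal (par.cacheProb_mem _ f hf).1, ENNReal.toReal_ofReal (by positivity)]
  simp only [pow_one, Nat.factorial_one, Nat.cast_one, div_one]
  have e : par.density .picoBS * (par.losRadius ^ 2 * Real.pi) =
      Real.pi * par.density .picoBS * par.losRadius ^ 2 := by ring
  rw [e]
  ring

end HetNet.IsModel

/-! ### From rates to SINR thresholds. -/

section DataRate

lemma measurable_dataRate (B : ℝ) : Measurable (dataRate B) := by
  refine Measurable.ite (measurableSet_singleton _) measurable_const ?_
  unfold Real.logb
  exact (((Real.measurable_log.comp (measurable_const.add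
    measurable_id.ennreal_toReal)).div_const _).const_mul B).ennreal_ofReal

lemma dataRate_ofReal (B : ℝ) {y : ℝ} (hy : 0 ≤ y) :
    dataRate B (ENNReal.ofReal y) = ENNReal.ofReal (B * Real.logb 2 (1 + y)) := by
  rw [dataRate, if_neg ENNReal.ofReal_ne_top, ENNReal.toReal_ofReal hy]

lemma lt_dataRate_iff {B R : ℝ} (hB : 0 < B) (hR : 0 ≤ R) (s : ℝ≥0∞) :
    ENNReal.ofReal R < dataRate B s ↔ ENNReal.ofReal (2 ^ (R / B) - 1) < s := by
  rcases eq_or_ne s ⊤ with rfl | hs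
  · simp [dataRate]
  obtain ⟨y, hy, rfl⟩ : ∃ y : ℝ, 0 ≤ y ∧ s = ENNReal.ofReal y :=
    ⟨s.toReal, ENNReal.toReal_nonneg, (ENNReal.ofReal_toReal hs).symm⟩
  have h1 : (1 : ℝ) ≤ 2 ^ (R / B) := Real.one_le_rpow one_le_two (by positivity)
  rw [dataRate_ofReal B hy, ENNReal.ofReal_lt_ofReal_iff_of_nonneg hR,
    ENNReal.ofReal_lt_ofReal_iff_of_nonneg (by linarith), ← div_lt_iff₀' hB,
    Real.lt_logb_iff_rpow_lt one_lt_two (by linarith), sub_lt_iff_lt_add']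

/-- Solving the comparison of biased rates for `s'` produces the change of scale `φ`. An infinite
`s'` fails both sides; `s` must be finite, as `toReal` would turn `⊤` into `0`. -/
lemma mul_dataRate_lt_iff {b B b' B' : ℝ} (hb : 0 < b) (hb' : 0 < b') (hB' : 0 < B')
    {s : ℝ≥0∞} (hs : s ≠ ⊤) (s' : ℝ≥0∞) :
    ENNReal.ofReal b' * dataRate B' s' < ENNReal.ofReal b * dataRate B s ↔
      s' < ENNReal.ofReal ((1 + s.toReal) ^ (b * B / (b' * B')) - 1) := by
  rcases eq_or_ne s' ⊤ with rfl | hs'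
  · simp [dataRate, ENNReal.mul_top, hb']
  obtain ⟨y, hy, rfl⟩ : ∃ y : ℝ, 0 ≤ y ∧ s = ENNReal.ofReal y :=
    ⟨s.toReal, ENNReal.toReal_nonneg, (ENNReal.ofReal_toReal hs).symm⟩
  obtain ⟨y', hy', rfl⟩ : ∃ y : ℝ, 0 ≤ y ∧ s' = ENNReal.ofReal y :=
    ⟨s'.toReal, ENNReal.toReal_nonneg, (ENNReal.ofReal_toReal hs').symm⟩
  have hl : 0 ≤ Real.logb 2 (1 + y') := Real.logb_nonneg one_lt_two (by linarith)
  have hp : 0 < (1 + y) ^ (b * B / (b' * B')) := Real.rpow_pos_of_pos (by linarith) _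
  rw [dataRate_ofReal _ hy, dataRate_ofReal _ hy', ← ENNReal.ofReal_mul hb'.le,
    ← ENNReal.ofReal_mul hb.le, ENNReal.ofReal_lt_ofReal_iff_of_nonneg (by positivity),
    ENNReal.ofReal_lt_ofReal_iff_of_nonneg hy', ENNReal.toReal_ofReal hy, ← mul_assoc, ← mul_assoc,
    lt_sub_iff_add_lt', ← Real.logb_lt_logb_iff one_lt_two (by linarith) hp,
    Real.logb_rpow_eq_mul_logb_of_pos (by linarith), div_mul_eq_mul_div,
    lt_div_iff₀' (by positivity)]

end DataRate

lemma sum_tier {M : Type*} [AddCommMonoid M] (F : Tier → M) :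
    ∑ i, F i = F .macroBS + F .picoBS :=
  Finset.sum_pair (by simp)

lemma HetNetParams.zipf_nonneg (par : HetNetParams) (f : ℕ) : 0 ≤ par.zipf f := by
  unfold zipf
  positivity

lemma HetNetParams.sum_zipf (par : HetNetParams) :
    ∑ f ∈ Finset.Icc 1 par.numFiles, par.zipf f = 1 := by
  unfold zipf
  rw [← Finset.sum_div]
  refine div_self (Finset.sum_pos (fun n hn => ?_) ?_).ne'
  · exact Real.rpow_pos_of_pos (by exact_mod_cast (Finset.mem_Icc.1 hn).1) _
  · exact Finset.nonempty_Icc.2 par.numFiles_pos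

/-! ### The success probability. -/

namespace HetNet

/-- The file `f` is delivered at a rate above `R` by the associated tier. -/
def Delivered {Ω : Type*} (net : HetNet Ω) (par : HetNetParams) (R : ℝ) (f : ℕ) (ω : Ω) : Prop :=
  ∃ i, net.Associated par i f ω ∧ ENNReal.ofReal R < net.tierRate par i f ω

/-- The request for `f` succeeds, regardless of whether `f` is requested. -/
def Served {Ω : Type*} (net : HetNet Ω) (par : HetNetParams) (R : ℝ) (f : ℕ) (ω : Ω) : Prop :=
  (f ≤ par.numCached ∧ net.Delivered par R f ω) ∨
  (par.numCached < f ∧ R ≤ par.backhaul ∧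
      ENNReal.ofReal R < dataRate (par.bandwidth .macroBS) (net.serverSinr par ω))

lemma measurableSet_associated {Ω : Type*} [MeasurableSpace Ω] {net : HetNet Ω}
    {par : HetNetParams} {f : ℕ} (h : ∀ i, Measurable (net.sinr par i f)) (R : ℝ) (i : Tier) :
    MeasurableSet {ω | net.Associated par i f ω ∧ ENNReal.ofReal R < net.tierRate par i f ω} := by
  have hr : ∀ i, Measurable (net.tierRate par i f) := fun i => (measurable_dataRate _).comp (h i)
  exact (measurableSet_lt ((hr _).const_mul _) ((hr _).const_mul _)).inter
    (measurableSet_lt measurable_const (hr i))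

lemma measurableSet_served {Ω : Type*} [MeasurableSpace Ω] {net : HetNet Ω}
    {par : HetNetParams} {f : ℕ} (h : ∀ i, Measurable (net.sinr par i f))
    (hs : Measurable (net.serverSinr par)) (R : ℝ) : MeasurableSet {ω | net.Served par R f ω} := by
  have h1 : MeasurableSet {ω | net.Delivered par R f ω} := by
    have e : {ω | net.Delivered par R f ω} = ⋃ i,
        {ω | net.Associated par i f ω ∧ ENNReal.ofReal R < net.tierRate par i f ω} := by
      ext ω
      simp [Delivered]
    rw [e]
    exact MeasurableSet.iUnion fun i => measurableSet_associated h R i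
  exact ((MeasurableSet.const _).inter h1).union ((MeasurableSet.const _).inter
    ((MeasurableSet.const _).inter
      (measurableSet_lt measurable_const ((measurable_dataRate _).comp hs))))

namespace IsModel

variable {Ω : Type*} [MeasurableSpace Ω] {μ : Measure Ω} {net : HetNet Ω}
  {par : HetNetParams} {R : ℝ}

/-- For a fixed file, being served depends only on sources that belong to a tier, and the request is
the one source that does not. -/
lemma measure_request_inter_served (hnet : net.IsModel par μ) {f : ℕ}
    (hf : f ∈ Finset.Icc 1 par.numFiles) :
    μ.real ({ω | net.request ω = f} ∩ {ω | net.Served par R f ω}) =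
      par.zipf f * μ.real {ω | net.Served par R f ω} := by
  have hI := hnet.indep_sourcesAlgebra (S := {s | s.tier = none}) (T := {s | s.tier ≠ none})
    (by rw [Set.disjoint_left]; exact fun s h1 h2 => h2 h1)
  have hT : ∀ i (s : Source), s.tier = some i → s ∈ {s : Source | s.tier ≠ none} := by
    intro i s h
    rw [mem_ofPred_eq, h]
    simp
  have h1 : MeasurableSet[net.sourcesAlgebra {s | s.tier = none}] {ω | net.request ω = f} :=
    (measurable_request_sources (net := net) (S := {s | s.tier = none}) rfl)
      (measurableSet_singleton f)
  have h2 : MeasurableSet[net.sourcesAlgebra {s | s.tier ≠ none}] {ω | net.Served par R f ω} :=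
    @measurableSet_served Ω (net.sourcesAlgebra {s | s.tier ≠ none}) net par f
      (fun i => measurable_sinr_sources (hT i) f) (measurable_serverSinr_sources (hT _)) R
  rw [measureReal_def, (Indep_iff _ _ μ).1 hI _ _ h1 h2, hnet.law_request f hf, ENNReal.toReal_mul,
    ENNReal.toReal_ofReal (par.zipf_nonneg f), measureReal_def]

lemma serverTerm_eq (hR : 0 ≤ R) :
    net.serverTerm par μ R = ∑ f ∈ Finset.Icc (par.numCached + 1) par.numFiles,
      par.zipf f * μ.real {ω | net.Served par R f ω} := by
  have h : ∀ f ∈ Finset.Icc (par.numCached + 1) par.numFiles,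
      μ.real {ω | net.Served par R f ω} = unitStep (par.backhaul - R) *
        net.serverCoverage par μ (2 ^ (R / par.bandwidth .macroBS) - 1) := by
    intro f hf
    have hf' : par.numCached < f := (Finset.mem_Icc.1 hf).1
    simp only [Served, not_le.2 hf', hf', false_and, true_and, false_or,
      lt_dataRate_iff (par.bandwidth_pos .macroBS) hR, unitStep, sub_nonneg]
    split_ifs with hb
    · simp [hb, serverCoverage]
    · simp [hb]
  rw [Finset.sum_congr rfl fun f hf => by rw [h f hf], serverTerm]
  -- The step function of `N_c - H_c - 1` only records whether the sum is empty, so it is `1` in the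
  -- first case and irrelevant in the second.
  rcases lt_or_ge par.numCached par.numFiles with hlt | hge
  · have : (par.numCached : ℝ) + 1 ≤ par.numFiles := by exact_mod_cast hlt
    have h1 : unitStep ((par.numFiles : ℝ) - par.numCached - 1) = 1 := if_pos (by linarith)
    rw [h1, mul_one, Finset.mul_sum]
    exact Finset.sum_congr rfl fun f _ => by ring
  · simp [Finset.Icc_eq_empty_of_lt (Nat.lt_succ_of_le hge)]

variable [IsProbabilityMeasure μ]

lemma integrableOn_maxRatePDF (hnet : net.IsModel par μ) (hR : 0 ≤ R) (i : Tier) (f : ℕ) :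
    IntegrableOn (net.maxRatePDF par μ i f) (Ioi (2 ^ (R / par.bandwidth i) - 1)) := by
  refine integrableOn_deriv_tail_mul (hnet.measurable_sinr i f) (hnet.differentiableOn_coverage i f)
    (φ := fun t => (1 + t) ^ (par.bias i * par.bandwidth i
      / (par.bias i.other * par.bandwidth i.other)) - 1)
    (((measurable_const.add measurable_id).pow_const _).sub_const 1) ?_
  exact sub_nonneg.2 (Real.one_le_rpow one_le_two (div_nonneg hR (par.bandwidth_pos i).le))

/-- Where the SINR of tier `i` is finite, this is the comparison of independent variables; where it
is infinite, tier `i` wins almost surely and every threshold is exceeded. -/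
lemma measure_associated (hnet : net.IsModel par μ) (hR : 0 ≤ R) (i : Tier) (f : ℕ) :
    μ.real {ω | net.Associated par i f ω ∧ ENNReal.ofReal R < net.tierRate par i f ω} =
      (∫ t in Ioi (2 ^ (R / par.bandwidth i) - 1), net.maxRatePDF par μ i f t) +
        μ.real {ω | net.sinr par i f ω = ⊤} := by
  set τ : ℝ := 2 ^ (R / par.bandwidth i) - 1
  set c := par.bias i * par.bandwidth i / (par.bias i.other * par.bandwidth i.other)
  have hb := par.bias_pos
  have hB := par.bandwidth_pos
  have hτ : 0 ≤ τ :=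
    sub_nonneg.2 (Real.one_le_rpow one_le_two (div_nonneg hR (par.bandwidth_pos i).le))
  have hc : 0 < c := div_pos (mul_pos (hb _) (hB _)) (mul_pos (hb _) (hB _))
  have key := measure_lt_eq_integral_deriv_tail (μ := μ) (hnet.measurable_sinr i f)
    (hnet.measurable_sinr i.other f) (hnet.indepFun_sinr i f) (hnet.differentiableOn_coverage i f)
    (hnet.differentiableOn_coverage i.other f) (φ := fun t => (1 + t) ^ c - 1)
    (((measurable_const.add measurable_id).pow_const _).sub_const 1)
    (fun t ht => sub_pos.2 (Real.one_lt_rpow (by linarith) hc)) hτ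
  have hint : (∫ t in Ioi τ, net.maxRatePDF par μ i f t) = ∫ t in Ioi τ,
      -deriv (tail μ (net.sinr par i f)) t * (1 - tail μ (net.sinr par i.other f) ((1 + t) ^ c - 1)) :=
    rfl
  have htop : MeasurableSet {ω | net.sinr par i f ω = ⊤} :=
    hnet.measurable_sinr i f (measurableSet_singleton ⊤)
  rw [hint, ← key, ← measureReal_union (by
    rw [Set.disjoint_left]
    intro ω h1 h2
    exact h1.1.2 h2) htop]
  refine measureReal_congr ?_
  -- Two infinite rates would tie and leave the user unassociated; this is null because the macro
  -- SINR is almost surely finite.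
  have hfin : ∀ᵐ ω ∂μ, net.sinr par i f ω = ⊤ → net.sinr par i.other f ω ≠ ⊤ := by
    filter_upwards [hnet.ae_sinr_macroBS_ne_top f] with ω hω h
    cases i with
    | macroBS => exact absurd h hω
    | picoBS => exact hω
  filter_upwards [hfin] with ω hω
  refine propext ?_
  change (_ ∧ _) ↔ ((_ ∧ _) ∧ _) ∨ net.sinr par i f ω = ⊤
  simp only [Associated, tierRate, lt_dataRate_iff (hB i) hR]
  by_cases h : net.sinr par i f ω = ⊤
  · simp only [h, ne_eq, not_true_eq_false, and_false, false_and, false_or, iff_true]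
    refine ⟨?_, ENNReal.ofReal_lt_top⟩
    rw [dataRate, dataRate, if_pos rfl, if_neg (hω h), ENNReal.mul_top]
    · exact ENNReal.mul_lt_top ENNReal.ofReal_lt_top ENNReal.ofReal_lt_top
    · exact (ENNReal.ofReal_pos.2 (hb i)).ne'
  · rw [mul_dataRate_lt_iff (hb i) (hb i.other) (hB i.other) h]
    tauto

lemma measure_delivered (hnet : net.IsModel par μ) (hR : 0 ≤ R) (f : ℕ) :
    μ.real {ω | net.Delivered par R f ω} =
      (∑ i, ∫ t in Ioi (2 ^ (R / par.bandwidth i) - 1), net.maxRatePDF par μ i f t) +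
        μ.real {ω | net.sinr par .picoBS f ω = ⊤} := by
  have e : {ω | net.Delivered par R f ω} =
      {ω | net.Associated par .macroBS f ω ∧ ENNReal.ofReal R < net.tierRate par .macroBS f ω} ∪
      {ω | net.Associated par .picoBS f ω ∧ ENNReal.ofReal R < net.tierRate par .picoBS f ω} := by
    ext ω
    constructor
    · rintro ⟨i, hi⟩
      cases i with
      | macroBS => exact Or.inl hi
      | picoBS => exact Or.inr hi
    · rintro (h | h)
      · exact ⟨_, h⟩
      · exact ⟨_, h⟩
  have hm1 : μ.real {ω | net.sinr par .macroBS f ω = ⊤} = 0 := by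
    rw [measureReal_eq_zero_iff]
    exact measure_eq_zero_iff_ae_notMem.2 (hnet.ae_sinr_macroBS_ne_top f)
  rw [e, measureReal_union _
    (measurableSet_associated (fun i => hnet.measurable_sinr i f) R .picoBS),
    hnet.measure_associated hR, hnet.measure_associated hR, hm1, sum_tier]
  · ring
  · rw [Set.disjoint_left]
    intro ω h1 h2
    exact lt_asymm h1.1 h2.1

/-- The model prescribes the law of the request only on the catalog; since the Zipf weights sum to
`1`, no mass is left elsewhere. -/
lemma ae_request_mem (hnet : net.IsModel par μ) :
    ∀ᵐ ω ∂μ, net.request ω ∈ Finset.Icc 1 par.numFiles := by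
  have hm : MeasurableSet {ω | net.request ω ∈ Finset.Icc 1 par.numFiles} :=
    hnet.measurable_request (MeasurableSet.of_discrete (s := {n | n ∈ Finset.Icc 1 par.numFiles}))
  refine (mem_ae_iff_prob_eq_one hm).2 ?_
  have e : {ω | net.request ω ∈ Finset.Icc 1 par.numFiles} =
      ⋃ f ∈ Finset.Icc 1 par.numFiles, {ω | net.request ω = f} := by
    ext ω
    simp
  rw [e, measure_biUnion_finset (f := fun f => {ω | net.request ω = f}) (fun f _ g _ hfg => by
      rw [Function.onFun, Set.disjoint_left]
      exact fun ω h1 h2 => hfg (h1.symm.trans h2))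
    (fun f _ => hnet.measurable_request (measurableSet_singleton f)),
    Finset.sum_congr rfl hnet.law_request,
    ← ENNReal.ofReal_sum_of_nonneg fun f _ => par.zipf_nonneg f, par.sum_zipf, ENNReal.ofReal_one]

lemma successProb_eq_sum (hnet : net.IsModel par μ) :
    net.successProb par μ R =
      ∑ f ∈ Finset.Icc 1 par.numFiles, par.zipf f * μ.real {ω | net.Served par R f ω} := by
  have hae : {ω | net.Success par R ω} =ᵐ[μ] (⋃ f ∈ Finset.Icc 1 par.numFiles,
      ({ω | net.request ω = f} ∩ {ω | net.Served par R f ω}) : Set Ω) := by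
    filter_upwards [hnet.ae_request_mem] with ω hω
    refine propext ?_
    change net.Success par R ω ↔ ω ∈ ⋃ f ∈ Finset.Icc 1 par.numFiles,
      ({ω | net.request ω = f} ∩ {ω | net.Served par R f ω})
    simp only [mem_iUnion]
    constructor
    · intro h
      exact ⟨_, hω, rfl, h⟩
    · rintro ⟨f, -, rfl, h⟩
      exact h
  rw [successProb, measureReal_congr hae, measureReal_biUnion_finset]
  · exact Finset.sum_congr rfl fun f hf => hnet.measure_request_inter_served hf
  · intro f _ g _ hfg
    rw [Function.onFun, Set.disjoint_left]
    exact fun ω h1 h2 => hfg (h1.1.symm.trans h2.1)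
  · exact fun f _ => (hnet.measurable_request (measurableSet_singleton f)).inter
      (measurableSet_served (fun i => hnet.measurable_sinr i f) hnet.measurable_serverSinr R)

/-- The success probability, up to the probability of interference-free links. -/
lemma successProb_eq (hnet : net.IsModel par μ) (hR : 0 ≤ R) :
    net.successProb par μ R =
      (∑ f ∈ Finset.Icc 1 par.numCached, ∑ i : Tier,
        par.zipf f * ∫ t in Ioi (2 ^ (R / par.bandwidth i) - 1), net.maxRatePDF par μ i f t)
      + net.serverTerm par μ R
      + ∑ f ∈ Finset.Icc 1 par.numCached,
          par.zipf f * μ.real {ω | net.sinr par .picoBS f ω = ⊤} := by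
  have hsplit : Finset.Icc 1 par.numFiles =
      Finset.Icc 1 par.numCached ∪ Finset.Icc (par.numCached + 1) par.numFiles := by
    have := par.numCached_le
    ext f
    simp only [Finset.mem_union, Finset.mem_Icc]
    omega
  have hdisj : Disjoint (Finset.Icc 1 par.numCached)
      (Finset.Icc (par.numCached + 1) par.numFiles) := by
    rw [Finset.disjoint_left]
    intro f h1 h2
    rw [Finset.mem_Icc] at h1 h2
    omega
  rw [hnet.successProb_eq_sum, hsplit, Finset.sum_union hdisj, serverTerm_eq hR, add_right_comm,
    ← Finset.sum_add_distrib]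
  congr 1
  refine Finset.sum_congr rfl fun f hf => ?_
  have hf' : f ≤ par.numCached := (Finset.mem_Icc.1 hf).2
  rw [← Finset.mul_sum, ← mul_add, ← hnet.measure_delivered hR]
  simp [Served, hf', not_lt.2 hf']

end IsModel

end HetNet

theorem theorem4 {Ω : Type*} [MeasurableSpace Ω] (μ : Measure Ω) [IsProbabilityMeasure μ]
    (par : HetNetParams) (net : HetNet Ω) (hnet : net.IsModel par μ) (R : ℝ) (hR : 0 ≤ R) :
    (∀ f ∈ Finset.Icc 1 par.numCached, ∀ i : Tier,
      DifferentiableOn ℝ (net.coverage par μ i f) (Ioi 0) ∧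
      IntegrableOn (net.maxRatePDF par μ i f) (Ioi (2 ^ (R / par.bandwidth i) - 1))) ∧
    (0 < par.noise .picoBS →
      net.successProb par μ R =
        (∑ f ∈ Finset.Icc 1 par.numCached, ∑ i : Tier,
          par.zipf f * ∫ t in Ioi (2 ^ (R / par.bandwidth i) - 1), net.maxRatePDF par μ i f t)
        + net.serverTerm par μ R) ∧
    (par.noise .picoBS = 0 →
      net.successProb par μ R =
        (∑ f ∈ Finset.Icc 1 par.numCached, ∑ i : Tier,
          par.zipf f * ∫ t in Ioi (2 ^ (R / par.bandwidth i) - 1), net.maxRatePDF par μ i f t)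
        + net.serverTerm par μ R
        + ∑ f ∈ Finset.Icc 1 par.numCached, par.zipf f *
            (par.cacheProb .picoBS f *
              (Real.pi * par.density .picoBS * par.losRadius ^ 2 *
                Real.exp (-(Real.pi * par.density .picoBS * par.losRadius ^ 2))))) := by
  refine ⟨fun f _ i => ⟨hnet.differentiableOn_coverage i f, hnet.integrableOn_maxRatePDF hR i f⟩,
    fun hn => ?_, fun hn => ?_⟩
  · rw [hnet.successProb_eq hR, add_eq_left]
    refine Finset.sum_eq_zero fun f _ => ?_
    simp [HetNet.sinr_ne_top_of_noise hn f]
  · rw [hnet.successProb_eq hR]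
    congr 1
    exact Finset.sum_congr rfl fun f hf => by rw [hnet.measure_sinr_pico_eq_top hn hf]
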